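/- Let $\ell$ be an odd prime number, let $K$ be a number field containing the $\ell$-th roots of unity, and let $L/K$ be a finite Galois extension whose Galois group is an $\ell$-group. For a number field $F$, put $\mathcal R_F=\mathbb Z_\ell\otimes_{\mathbb Z}F^\times$ and, for a finite place $v$ of $F$, $\mathcal R_{F_v}=\varprojlim_n F_v^\times/F_v^{\times\ell^n}$, with the localisation map $\mathcal R_F\to\mathcal R_{F_v}$; let $\mu_{F_v}$ be the group of roots of unity of $\ell$-power order in $F_v$, viewed in $\mathcal R_{F_v}$. Let $\mathcal R_F^{bp}\subset\mathcal R_F$ be the submodule of pseudo-infinitesimal elements, i.e. of those whose image in $\mathcal R_{F_v}$ lies in $\mu_{F_v}$ for every $v\mid\ell$. Let $\mathcal D'_F$ be the free $\mathbb Z_\ell$-module on the finite places of $F$ not dividing $\ell$, $\mathcal P_F^{bp}\subset\mathcal D'_F$ the image of $\mathcal R_F^{bp}$ under the divisor map, and $\mathcal C\ell_F^{bp}=\mathcal D'_F/\mathcal P_F^{bp}$. For a finite extension $F/K$, let $\mathrm{Cap}^{bp}_{F/K}\subset\mathcal C\ell_K^{bp}$ be the kernel of the morphism $\mathcal C\ell_K^{bp}\to\mathcal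 C\ell_F^{bp}$ induced by extension of divisors. A finite extension $F/K$ is called locally cyclotomic (or logarithmically unramified) if, for every place $w$ of $F$ above a place $v$ of $K$, the local extension $F_w/K_v$ is contained in the cyclotomic $\mathbb Z_\ell$-extension of $K_v$ (which is trivial if $v$ is infinite). Assume the Leopoldt conjecture for $L$ and $\ell$: the diagonal map $\mathbb Z_\ell\otimes_{\mathbb Z}\mathcal O_L^\times\to\prod_{v\mid\ell}\mathcal R_{L_v}$ is injective. Let $L'$ be the compositum of the subextensions of $L/K$ that are locally cyclotomic over $K$. Then $L'$ is the largest subextension of $L/K$ that is locally cyclotomic over $K$, and $$\mathrm{Cap}^{bp}_{L/K}=\mathrm{Cap}^{bp}_{L'/K}.$$ -/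

import Mathlib

open NumberField IsDedekindDomain
open scoped TensorProduct

set_option linter.unusedSectionVars false

namespace PseudoInfinitesimal

noncomputable section

/-! ### Pro-`ℓ` completions of abelian groups -/

section ProCompletion

variable (ℓ : ℕ) [Fact ℓ.Prime]

/-- The pro-`ℓ` completion `lim A / ℓ ^ n A` of an abelian group `A` (written additively). -/
def ProCompletion (A : Type*) [AddCommGroup A] : Type _ :=
  AdicCompletion (Ideal.span {(ℓ : ℤ)}) A

instance (A : Type*) [AddCommGroup A] : AddCommGroup (ProCompletion ℓ A) :=
  inferInstanceAs (AddCommGroup (AdicCompletion (Ideal.span {(ℓ : ℤ)}) A))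

/-- Reduction `ℤ_ℓ → ℤ / (ℓ) ^ n`. -/
def padicReduction (n : ℕ) : ℤ_[ℓ] →+* ℤ ⧸ (Ideal.span {(ℓ : ℤ)}) ^ n :=
  ((Int.quotientSpanNatEquivZMod (ℓ ^ n)).symm.trans
    (Ideal.quotEquivOfEq (by rw [Ideal.span_singleton_pow]; push_cast; rfl))).toRingHom.comp
    (PadicInt.toZModPow n)

/-- The canonical map from `ℤ_ℓ` to `lim ℤ / (ℓ) ^ n`. -/
def padicToCompletion : ℤ_[ℓ] →+* AdicCompletion (Ideal.span {(ℓ : ℤ)}) ℤ :=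
  AdicCompletion.liftRingHom _ (padicReduction ℓ) (by
    intro m n hmn
    ext a
    obtain ⟨z, hz⟩ := ZMod.intCast_surjective (PadicInt.toZModPow n a)
    have hz' : PadicInt.toZModPow m a = (z : ZMod (ℓ ^ m)) := by
      rw [← PadicInt.cast_toZModPow m n hmn, ← hz, ZMod.cast_intCast (pow_dvd_pow ℓ hmn)]
    simp only [padicReduction, RingHom.comp_apply, hz', ← hz, map_intCast])

/-- `ℤ_ℓ` acts on `lim A / ℓ ^ n A` through its quotients `ℤ / ℓ ^ n`. -/
instance (A : Type*) [AddCommGroup A] : Module ℤ_[ℓ] (ProCompletion ℓ A) :=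
  Module.compHom (AdicCompletion (Ideal.span {(ℓ : ℤ)}) A) (padicToCompletion ℓ)

/-- The canonical map `A → lim A / ℓ ^ n A`. -/
def ProCompletion.of (A : Type*) [AddCommGroup A] : A →ₗ[ℤ] ProCompletion ℓ A :=
  AdicCompletion.of (Ideal.span {(ℓ : ℤ)}) A

/-- Functoriality of pro-`ℓ` completions. -/
def ProCompletion.map {A B : Type*} [AddCommGroup A] [AddCommGroup B] (f : A →ₗ[ℤ] B) :
    ProCompletion ℓ A →ₗ[ℤ_[ℓ]] ProCompletion ℓ B where
  toFun := AdicCompletion.map (Ideal.span {(ℓ : ℤ)}) f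
  map_add' x y := map_add (AdicCompletion.map (Ideal.span {(ℓ : ℤ)}) f) x y
  map_smul' a x := (AdicCompletion.map (Ideal.span {(ℓ : ℤ)}) f).map_smul (padicToCompletion ℓ a) x

theorem ProCompletion.map_of {A B : Type*} [AddCommGroup A] [AddCommGroup B] (f : A →ₗ[ℤ] B)
    (x : A) : ProCompletion.map ℓ f (ProCompletion.of ℓ A x) = ProCompletion.of ℓ B (f x) := rfl

end ProCompletion

/-- The homomorphism of (additively written) unit groups induced by a ring homomorphism. -/
def unitsMap {R S : Type*} [CommRing R] [CommRing S] (f : R →+* S) :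
    Additive Rˣ →ₗ[ℤ] Additive Sˣ :=
  (MonoidHom.toAdditive (Units.map (f : R →* S))).toIntLinearMap

section Global

variable (ℓ : ℕ) [Fact ℓ.Prime] (K : Type*) [Field K] [NumberField K]

/-- `ℛ_K = ℤ_ℓ ⊗ Kˣ`. -/
abbrev GlobalGroup : Type _ := ℤ_[ℓ] ⊗[ℤ] Additive Kˣ

variable {K} in
/-- `ℛ_{K_v} = lim K_vˣ / (K_vˣ) ^ (ℓ ^ n)`, for a finite place `v` of `K`. -/
abbrev LocalGroup (v : HeightOneSpectrum (𝓞 K)) : Type _ :=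
  ProCompletion ℓ (Additive (v.adicCompletion K)ˣ)

variable {K} in
/-- The localisation map `ℛ_K → ℛ_{K_v}`. -/
def localization (v : HeightOneSpectrum (𝓞 K)) : GlobalGroup ℓ K →ₗ[ℤ_[ℓ]] LocalGroup ℓ v :=
  LinearMap.liftBaseChange ℤ_[ℓ]
    (ProCompletion.of ℓ _ ∘ₗ unitsMap (algebraMap K (v.adicCompletion K)))

variable {K} in
/-- The (image in `ℛ_{K_v}` of the) group `μ_{K_v}` of roots of unity of `ℓ`-power order
in `K_v`. -/
def localRootsOfUnity (v : HeightOneSpectrum (𝓞 K)) : Submodule ℤ_[ℓ] (LocalGroup ℓ v) :=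
  Submodule.span ℤ_[ℓ]
    {x | ∃ ζ : (v.adicCompletion K)ˣ, (∃ n : ℕ, ζ ^ ℓ ^ n = 1) ∧
      x = ProCompletion.of ℓ _ (Additive.ofMul ζ)}

variable {K} in
/-- The finite place `v` divides `ℓ`. -/
def IsAbove (v : HeightOneSpectrum (𝓞 K)) : Prop := (ℓ : 𝓞 K) ∈ v.asIdeal

/-- The pseudo-infinitesimal elements `ℛ_K^bp` of `ℛ_K`: those which are locally roots of unity
at all the places above `ℓ`. -/
def pseudoInfinitesimals : Submodule ℤ_[ℓ] (GlobalGroup ℓ K) :=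
  ⨅ (v : HeightOneSpectrum (𝓞 K)) (_ : IsAbove ℓ v),
    (localRootsOfUnity ℓ v).comap (localization ℓ v)

/-- `𝒟'_K`: the free `ℤ_ℓ`-module on the finite places of `K` that do not divide `ℓ`. -/
abbrev Divisors : Type _ := {v : HeightOneSpectrum (𝓞 K) // ¬ IsAbove ℓ v} →₀ ℤ_[ℓ]

variable {K} in
/-- The exponent of `v` in the factorisation of the principal fractional ideal `(x)`. -/
def ord (v : HeightOneSpectrum (𝓞 K)) (x : Kˣ) : ℤ := -(v.valuationOfNeZero x).toAdd

theorem finite_ord_ne_zero (x : Kˣ) : {v : HeightOneSpectrum (𝓞 K) | ord v x ≠ 0}.Finite := by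
  have h1 := HeightOneSpectrum.Support.finite (𝓞 K) (x : K)
  have h2 := HeightOneSpectrum.Support.finite (𝓞 K) ((x⁻¹ : Kˣ) : K)
  refine (h1.union h2).subset fun v hv => ?_
  by_contra hcon
  simp only [HeightOneSpectrum.Support, Set.mem_union, Set.mem_ofPred_eq, not_or, not_lt] at hcon
  rw [← HeightOneSpectrum.valuationOfNeZero_eq, ← HeightOneSpectrum.valuationOfNeZero_eq,
    ← WithZero.coe_one, WithZero.coe_le_coe, WithZero.coe_le_coe, map_inv] at hcon
  refine hv ?_
  have h := le_antisymm hcon.1 (inv_le_one'.mp hcon.2)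
  simp [ord, h]

variable {K} in
theorem ord_one (v : HeightOneSpectrum (𝓞 K)) : ord v (1 : Kˣ) = 0 := by simp [ord]

variable {K} in
theorem ord_mul (v : HeightOneSpectrum (𝓞 K)) (x y : Kˣ) :
    ord v (x * y) = ord v x + ord v y := by
  rw [ord, ord, ord, map_mul, toAdd_mul, neg_add]

/-- The prime-to-`ℓ` part of the divisor of an element of `Kˣ`. -/
def principalDivisor : Additive Kˣ →ₗ[ℤ] Divisors ℓ K :=
  AddMonoidHom.toIntLinearMap
    { toFun := fun x => Finsupp.ofSupportFinite (fun v => ((ord v.1 x.toMul : ℤ) : ℤ_[ℓ])) <|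
        ((finite_ord_ne_zero K x.toMul).preimage Subtype.val_injective.injOn).subset
          fun v hv h => hv (by change ((ord v.1 x.toMul : ℤ) : ℤ_[ℓ]) = 0; rw [h, Int.cast_zero])
      map_zero' := Finsupp.ext fun v => by
        change ((ord v.1 (1 : Kˣ) : ℤ) : ℤ_[ℓ]) = 0
        rw [ord_one, Int.cast_zero]
      map_add' := fun x y => Finsupp.ext fun v => by
        change ((ord v.1 (x.toMul * y.toMul) : ℤ) : ℤ_[ℓ]) =
          ((ord v.1 x.toMul : ℤ) : ℤ_[ℓ]) + ((ord v.1 y.toMul : ℤ) : ℤ_[ℓ])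
        rw [ord_mul, Int.cast_add] }

/-- The divisor map `ℛ_K → 𝒟'_K`. -/
def divisor : GlobalGroup ℓ K →ₗ[ℤ_[ℓ]] Divisors ℓ K :=
  LinearMap.liftBaseChange ℤ_[ℓ] (principalDivisor ℓ K)

/-- `𝒫_K^bp`: the principal divisors generated by the pseudo-infinitesimal elements. -/
def pseudoPrincipal : Submodule ℤ_[ℓ] (Divisors ℓ K) :=
  (pseudoInfinitesimals ℓ K).map (divisor ℓ K)

/-- The group of pseudo-infinitesimal classes `𝒞ℓ_K^bp = 𝒟'_K / 𝒫_K^bp`. -/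
abbrev PseudoClassGroup : Type _ := Divisors ℓ K ⧸ pseudoPrincipal ℓ K

/-- The Leopoldt conjecture for the number field `K` and the prime `ℓ`: the diagonal map from
`ℤ_ℓ ⊗ 𝓞_Kˣ` to the product of the pro-`ℓ` completions of the groups `K_vˣ`, for `v` above `ℓ`,
is injective. -/
def Leopoldt : Prop :=
  Function.Injective
    (LinearMap.pi (fun v : {v : HeightOneSpectrum (𝓞 K) // IsAbove ℓ v} => localization ℓ v.1) ∘ₗ
      LinearMap.baseChange ℤ_[ℓ] (unitsMap (algebraMap (𝓞 K) K)))

end Global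

section Extension

variable (ℓ : ℕ) [Fact ℓ.Prime] (K : Type*) [Field K] [NumberField K]
  (L : Type*) [Field L] [NumberField L] [Algebra K L]

instance (w : HeightOneSpectrum (𝓞 L)) : w.asIdeal.LiesOver (w.under (𝓞 K)).asIdeal := ⟨rfl⟩

variable {L} in
theorem continuous_algebraMap_withVal (w : HeightOneSpectrum (𝓞 L)) :
    Continuous (algebraMap (WithVal ((w.under (𝓞 K)).valuation K)) (WithVal (w.valuation L))) :=
  (HeightOneSpectrum.uniformContinuous_algebraMap_liesOver K L (w.under (𝓞 K)) w).continuous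

variable {L} in
/-- The homomorphism of completions `K_v → L_w` extending `K → L`, for a finite place `w` of `L`
and the place `v` of `K` below `w`. -/
def completionMap (w : HeightOneSpectrum (𝓞 L)) :
    (w.under (𝓞 K)).adicCompletion K →+* w.adicCompletion L :=
  (HeightOneSpectrum.adicCompletion.equiv L w).symm.toRingHom.comp
    ((UniformSpace.Completion.mapRingHom _ (continuous_algebraMap_withVal K w)).comp
      (HeightOneSpectrum.adicCompletion.equiv K (w.under (𝓞 K))).toRingHom)

variable {L} in
theorem completionMap_algebraMap (w : HeightOneSpectrum (𝓞 L)) (x : K) :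
    completionMap K w (algebraMap K _ x) = algebraMap L _ (algebraMap K L x) := by
  apply HeightOneSpectrum.adicCompletion.ext
  exact UniformSpace.Completion.mapRingHom_coe (continuous_algebraMap_withVal K w)
    (WithVal.toVal _ x)

variable {L} in
theorem isAbove_under (w : HeightOneSpectrum (𝓞 L)) : IsAbove ℓ (w.under (𝓞 K)) ↔ IsAbove ℓ w := by
  simp [IsAbove, Ideal.under_def, Ideal.mem_comap]

variable {L} in
/-- The place of `K` below a place of `L` that does not divide `ℓ`. -/
def placeBelow (w : {w : HeightOneSpectrum (𝓞 L) // ¬ IsAbove ℓ w}) :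
    {v : HeightOneSpectrum (𝓞 K) // ¬ IsAbove ℓ v} :=
  ⟨w.1.under (𝓞 K), fun h => w.2 ((isAbove_under ℓ K w.1).1 h)⟩

theorem finite_placesAbove (v : {v : HeightOneSpectrum (𝓞 K) // ¬ IsAbove ℓ v}) :
    (placeBelow ℓ K (L := L) ⁻¹' {v}).Finite := by
  have := v.1.isMaximal
  refine Set.Finite.of_finite_image (f := fun w => w.1.asIdeal)
    ((IsDedekindDomain.primesOver_finite v.1.asIdeal (𝓞 L)).subset ?_)
    fun a _ b _ h => Subtype.ext (HeightOneSpectrum.ext h)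
  rintro _ ⟨w, rfl, rfl⟩
  exact ⟨w.1.isPrime, ⟨rfl⟩⟩

/-- Extension of divisors `𝒟'_K → 𝒟'_L`, sending a place `v` to `∑ e(w/v) w`, the sum being over
the places `w` of `L` above `v`. -/
def extendDivisor : Divisors ℓ K →ₗ[ℤ_[ℓ]] Divisors ℓ L where
  toFun D := Finsupp.ofSupportFinite
    (fun w => (w.1.asIdeal.ramificationIdx (𝓞 K) : ℤ_[ℓ]) * D (placeBelow ℓ K w)) <|
      (D.support.finite_toSet.preimage' fun v _ => finite_placesAbove ℓ K L v).subset
        fun w hw => by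
          rw [Set.mem_preimage, Finset.mem_coe, Finsupp.mem_support_iff]
          exact right_ne_zero_of_mul hw
  map_add' D E := Finsupp.ext fun w => mul_add _ (D (placeBelow ℓ K w)) (E (placeBelow ℓ K w))
  map_smul' a D := Finsupp.ext fun w => mul_left_comm _ a (D (placeBelow ℓ K w))

/-- Extension of scalars `ℛ_K → ℛ_L`. -/
def extendGlobal : GlobalGroup ℓ K →ₗ[ℤ_[ℓ]] GlobalGroup ℓ L :=
  LinearMap.baseChange ℤ_[ℓ] (unitsMap (algebraMap K L))

variable {L} in
theorem ord_extend (w : HeightOneSpectrum (𝓞 L)) (x : Kˣ) :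
    ord w (Units.map (algebraMap K L : K →* L) x) =
      w.asIdeal.ramificationIdx (𝓞 K) * ord (w.under (𝓞 K)) x := by
  have h := HeightOneSpectrum.valuation_liesOver L (w.under (𝓞 K)) w (x : K)
  rw [Ideal.ramificationIdx'_eq_ramificationIdx _ _ (w.under (𝓞 K)).ne_bot,
    ← HeightOneSpectrum.valuationOfNeZero_eq,
    show algebraMap K L (x : K) = (Units.map (algebraMap K L : K →* L) x : Lˣ) from rfl,
    ← HeightOneSpectrum.valuationOfNeZero_eq, ← WithZero.coe_pow, WithZero.coe_inj] at h
  rw [ord, ord, ← h, toAdd_pow]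
  simp

theorem divisor_extendGlobal (x : GlobalGroup ℓ K) :
    divisor ℓ L (extendGlobal ℓ K L x) = extendDivisor ℓ K L (divisor ℓ K x) := by
  induction x using TensorProduct.induction_on with
  | zero => simp
  | add x y hx hy => simp only [map_add, hx, hy]
  | tmul a x =>
    simp only [extendGlobal, divisor, LinearMap.baseChange_tmul, LinearMap.liftBaseChange_tmul,
      map_smul]
    congr 1
    ext w
    change ((ord w.1 (Units.map (algebraMap K L : K →* L) x.toMul) : ℤ) : ℤ_[ℓ]) =
      (w.1.asIdeal.ramificationIdx (𝓞 K) : ℤ_[ℓ]) * ((ord (w.1.under (𝓞 K)) x.toMul : ℤ) : ℤ_[ℓ])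
    rw [ord_extend]
    push_cast
    rfl

variable {L} in
theorem localization_extendGlobal (w : HeightOneSpectrum (𝓞 L)) (x : GlobalGroup ℓ K) :
    localization ℓ w (extendGlobal ℓ K L x) =
      ProCompletion.map ℓ (unitsMap (completionMap K w))
        (localization ℓ (w.under (𝓞 K)) x) := by
  induction x using TensorProduct.induction_on with
  | zero => simp
  | add x y hx hy => simp only [map_add, hx, hy]
  | tmul a x =>
    simp only [extendGlobal, localization, LinearMap.baseChange_tmul,
      LinearMap.liftBaseChange_tmul, map_smul, LinearMap.comp_apply, ProCompletion.map_of]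
    congr 2
    exact congrArg Additive.ofMul (Units.ext (completionMap_algebraMap K w (x.toMul : K)).symm)

variable {L} in
theorem map_localRootsOfUnity (w : HeightOneSpectrum (𝓞 L)) :
    (localRootsOfUnity ℓ (w.under (𝓞 K))).map
      (ProCompletion.map ℓ (unitsMap (completionMap K w))) ≤ localRootsOfUnity ℓ w := by
  rw [localRootsOfUnity, Submodule.map_span_le]
  rintro _ ⟨ζ, ⟨n, hn⟩, rfl⟩
  refine Submodule.subset_span ⟨Units.map (completionMap K w : _ →* _) ζ, ⟨n, ?_⟩, rfl⟩
  rw [← map_pow, hn, map_one]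

theorem pseudoPrincipal_le_comap :
    pseudoPrincipal ℓ K ≤ (pseudoPrincipal ℓ L).comap (extendDivisor ℓ K L) := by
  rintro _ ⟨x, hx, rfl⟩
  refine ⟨extendGlobal ℓ K L x, ?_, divisor_extendGlobal ℓ K L x⟩
  simp only [pseudoInfinitesimals, SetLike.mem_coe, Submodule.mem_iInf, Submodule.mem_comap]
    at hx ⊢
  intro w hw
  rw [localization_extendGlobal]
  exact map_localRootsOfUnity ℓ K w ⟨_, hx _ ((isAbove_under ℓ K w).2 hw), rfl⟩

/-- The extension morphism `𝒞ℓ_K^bp → 𝒞ℓ_L^bp`. -/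
def extendClass : PseudoClassGroup ℓ K →ₗ[ℤ_[ℓ]] PseudoClassGroup ℓ L :=
  Submodule.mapQ _ _ (extendDivisor ℓ K L) (pseudoPrincipal_le_comap ℓ K L)

/-- The capitulation kernel `Cap_{L/K}^bp`. -/
def capitulation : Submodule ℤ_[ℓ] (PseudoClassGroup ℓ K) := LinearMap.ker (extendClass ℓ K L)

end Extension

section LocallyCyclotomic

variable (ℓ : ℕ)

/-- For an odd prime `ℓ` and a nonarchimedean local field `k` of characteristic `0`, the cyclotomic
`ℤ_ℓ`-extension of `k` (inside an algebraic closure): as `Gal(k(μ_{ℓ^∞})/k)` is the product of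
`ℤ_ℓ` and of a finite group of order prime to `ℓ`, this is the compositum of the
subextensions of `ℓ`-power degree of `k(μ_{ℓ^∞})`. -/
def cyclotomicZl (k : Type*) [Field k] : IntermediateField k (AlgebraicClosure k) :=
  sSup {E | E ≤ IntermediateField.adjoin k {ζ | ∃ n : ℕ, ζ ^ ℓ ^ n = 1} ∧
    ∃ m : ℕ, Module.finrank k E = ℓ ^ m}

/-- The extension of number fields `L/K` is locally cyclotomic (logarithmically unramified):
for every finite place `w` of `L`, above the place `v` of `K`, the local extension `L_w/K_v` is
contained in the cyclotomic `ℤ_ℓ`-extension of `K_v`; and `L_w = K_v` for every infinite place,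
the cyclotomic `ℤ_ℓ`-extension being trivial there. -/
def IsLocallyCyclotomic (K : Type*) [Field K] [NumberField K]
    (L : Type*) [Field L] [NumberField L] [Algebra K L] : Prop :=
  (∀ w : HeightOneSpectrum (𝓞 L),
    ∃ f : w.adicCompletion L →+* cyclotomicZl ℓ ((w.under (𝓞 K)).adicCompletion K),
      f.comp (completionMap K w) = algebraMap _ _) ∧
  IsUnramifiedAtInfinitePlaces K L

/-- The compositum of the subextensions of `L/K` which are locally cyclotomic over `K`. -/
def maxLocallyCyclotomic (K : Type*) [Field K] [NumberField K]
    (L : Type*) [Field L] [NumberField L] [Algebra K L] : IntermediateField K L :=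
  sSup {F | IsLocallyCyclotomic ℓ K F}

end LocallyCyclotomic

end

end PseudoInfinitesimal

/-!
The theorem holds for a local reason: along an automorphism that fixes enough local roots of unity,
a pseudo-infinitesimal element whose divisor comes from `K` cannot move.

Let `D` be a divisor of `K` whose class capitulates in `L`, so that its extension to `L` is the
divisor of some `x ∈ ℛ_L^bp`. For `σ ∈ Gal(L/K)`, the element `σ x / x` is pseudo-infinitesimal with
trivial divisor. Its orders at the places above `ℓ` vanish too, roots of unity being units, so it
comes from `ℤ_ℓ ⊗ 𝓞_Lˣ`; it is locally torsion above `ℓ`, and the Leopoldt conjecture shows that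
it is a global root of unity `ζ` (`exists_rootOfUnity_of_divisor_eq_zero`,
`exists_galoisAction_eq`).

Let `F` be the field fixed by the stabiliser of `x` in `Gal(L/K)`. It is locally cyclotomic. Indeed,
let `w` be a place of `L` above `v`. Then `L_w = K_v L` is Galois over `K_v`, of `ℓ`-power degree.
The image of `x` in `ℛ_{L_w}` is a root of unity if `w` divides `ℓ`; otherwise, modulo `ℓ ^ n`, it
is the product of an element of `K` and of a root of unity, because the units of `L_w` are
roots of unity modulo `ℓ ^ n`-th powers (`exists_rootOfUnity_mul_pow`,
`exists_eval_localization_eq`). So an automorphism `σ` of `L_w/K_v` that fixes the roots of unity of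
`ℓ`-power order in `L_w` fixes the image of `x`. As roots of unity embed in `ℛ_{L_w}`
(`eq_one_of_of_eq_zero`), this gives `ζ = 1`, that is `σ x = x`. By Galois theory `F` is contained
in the field generated over `K_v` by these roots of unity
(`algebraMap_mem_adjoin_rootsOfUnity`), which embeds in the cyclotomic `ℤ_ℓ`-extension.

Hence `F ⊆ L'`, and `x` is fixed by `Gal(L/L')`. By flatness of `ℤ_ℓ` it comes from `ℛ_{L'}`
(`exists_extendGlobal_eq`), and by taking local norms it is pseudo-infinitesimal there
(`mem_pseudoInfinitesimals_of_extendGlobal_mem`). So the class of `D` capitulates in `L'`.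

That `L'` itself is locally cyclotomic follows from the fact that the cyclotomic `ℤ_ℓ`-extension is
stable under all the automorphisms of the algebraic closure, so that the choice of the embeddings
of the completions is immaterial. The infinite places do not matter, since `[L : K]` is odd.
-/

namespace PseudoInfinitesimal

/-! ### Pro-`ℓ` completions and tensor products with `ℤ_ℓ` -/

section Completion

variable (ℓ : ℕ) [Fact ℓ.Prime] {A B : Type*} [AddCommGroup A] [AddCommGroup B]

/-- The projection `lim A / ℓ ^ n A → A / ℓ ^ n A`. -/
noncomputable def ProCompletion.eval (A : Type*) [AddCommGroup A] (n : ℕ) : ProCompletion ℓ A →+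
    A ⧸ ((Ideal.span {(ℓ : ℤ)}) ^ n • ⊤ : Submodule ℤ A) :=
  (AdicCompletion.eval (Ideal.span {(ℓ : ℤ)}) A n).toAddMonoidHom

variable {ℓ}

theorem mem_span_pow_smul_top_iff {n : ℕ} {a : A} :
    a ∈ ((Ideal.span {(ℓ : ℤ)}) ^ n • ⊤ : Submodule ℤ A) ↔ ∃ b : A, a = ℓ ^ n • b := by
  rw [Ideal.span_singleton_pow, Submodule.ideal_span_singleton_smul,
    Submodule.mem_smul_pointwise_iff_exists]
  simp only [Submodule.mem_top, true_and]
  refine exists_congr fun b => ?_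
  rw [eq_comm, ← natCast_zsmul]
  push_cast
  rfl

theorem ProCompletion.ext_eval {x y : ProCompletion ℓ A}
    (h : ∀ n, ProCompletion.eval ℓ A n x = ProCompletion.eval ℓ A n y) : x = y :=
  AdicCompletion.ext h

theorem ProCompletion.eval_of_eq_zero_iff {n : ℕ} {a : A} :
    ProCompletion.eval ℓ A n (ProCompletion.of ℓ A a) = 0 ↔ ∃ b : A, a = ℓ ^ n • b := by
  rw [← mem_span_pow_smul_top_iff]
  exact Submodule.Quotient.mk_eq_zero _

theorem ProCompletion.eval_pow_nsmul (n : ℕ) (x : ProCompletion ℓ A) :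
    ProCompletion.eval ℓ A n (ℓ ^ n • x) = 0 := by
  rw [map_nsmul]
  obtain ⟨a, ha⟩ := Submodule.Quotient.mk_surjective _ (ProCompletion.eval ℓ A n x)
  rw [← ha, ← Submodule.Quotient.mk_smul, Submodule.Quotient.mk_eq_zero,
    mem_span_pow_smul_top_iff]
  exact ⟨a, rfl⟩

theorem ProCompletion.exists_eval_eq (n : ℕ) (x : ProCompletion ℓ A) :
    ∃ a : A, ProCompletion.eval ℓ A n x = ProCompletion.eval ℓ A n (ProCompletion.of ℓ A a) := by
  obtain ⟨a, ha⟩ := Submodule.Quotient.mk_surjective _ (ProCompletion.eval ℓ A n x)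
  exact ⟨a, ha.symm⟩

theorem ProCompletion.eval_map_eq_zero (f : A →ₗ[ℤ] B) {n : ℕ} {x : ProCompletion ℓ A}
    (hx : ProCompletion.eval ℓ A n x = 0) :
    ProCompletion.eval ℓ B n (ProCompletion.map ℓ f x) = 0 := by
  have h := AdicCompletion.map_val_apply (Ideal.span {(ℓ : ℤ)}) f (n := n)
    (x : AdicCompletion (Ideal.span {(ℓ : ℤ)}) A)
  exact h.trans ((congrArg _ hx).trans (map_zero _))

theorem ProCompletion.eval_eq_eval_of_le {m n : ℕ} (hmn : m ≤ n) {x y : ProCompletion ℓ A}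
    (h : ProCompletion.eval ℓ A n x = ProCompletion.eval ℓ A n y) :
    ProCompletion.eval ℓ A m x = ProCompletion.eval ℓ A m y :=
  (AdicCompletion.transitionMap_comp_eval_apply _ _ hmn _).symm.trans <|
    (congrArg _ h).trans (AdicCompletion.transitionMap_comp_eval_apply _ _ hmn _)

theorem ProCompletion.map_map_eq_nsmul {f : A →ₗ[ℤ] B} {g : B →ₗ[ℤ] A} {d : ℕ}
    (h : ∀ a, g (f a) = d • a) (x : ProCompletion ℓ A) :
    ProCompletion.map ℓ g (ProCompletion.map ℓ f x) = d • x := by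
  refine ProCompletion.ext_eval fun n => ?_
  obtain ⟨a, ha⟩ := ProCompletion.exists_eval_eq n x
  have h0 : ProCompletion.eval ℓ A n (x - ProCompletion.of ℓ A a) = 0 := by
    rw [map_sub, ha, sub_self]
  have h1 := ProCompletion.eval_map_eq_zero g (ProCompletion.eval_map_eq_zero f h0)
  rw [map_sub, map_sub, ProCompletion.map_of, ProCompletion.map_of, h, map_sub, sub_eq_zero] at h1
  rw [h1, map_nsmul, map_nsmul, map_nsmul, ha]

theorem exists_pow_nsmul_eq_zero {M : Type*} [AddCommGroup M] [Module ℤ_[ℓ] M] {d : ℕ} (hd : d ≠ 0)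
    {x : M} (hx : d • x = 0) : ∃ k : ℕ, ℓ ^ k • x = 0 := by
  have hd0 : (d : ℤ_[ℓ]) ≠ 0 := by exact_mod_cast hd
  rw [← Nat.cast_smul_eq_nsmul ℤ_[ℓ], PadicInt.unitCoeff_spec hd0, mul_smul,
    ← Units.smul_def, smul_eq_zero_iff_eq] at hx
  refine ⟨(d : ℤ_[ℓ]).valuation, ?_⟩
  rwa [← Nat.cast_smul_eq_nsmul ℤ_[ℓ], Nat.cast_pow]

/-- If the `ℓ ^ k`-torsion of `A` is finite, then the `ℓ ^ k`-torsion of the pro-`ℓ` completion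
of `A` is the image of that of `A`. -/
theorem ProCompletion.exists_of_eq_of_nsmul_eq_zero {k : ℕ} (hfin : {a : A | ℓ ^ k • a = 0}.Finite)
    {x : ProCompletion ℓ A} (hx : ℓ ^ k • x = 0) :
    ∃ a : A, ℓ ^ k • a = 0 ∧ x = ProCompletion.of ℓ A a := by
  have key (n : ℕ) : ∃ a : A, ℓ ^ k • a = 0 ∧
      ProCompletion.eval ℓ A n x = ProCompletion.eval ℓ A n (ProCompletion.of ℓ A a) := by
    obtain ⟨t, ht⟩ := ProCompletion.exists_eval_eq (n + k) x
    have h0 : ProCompletion.eval ℓ A (n + k) (ProCompletion.of ℓ A (ℓ ^ k • t)) = 0 := by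
      rw [map_nsmul, map_nsmul, ← ht, ← map_nsmul, hx, map_zero]
    obtain ⟨s, hs⟩ := ProCompletion.eval_of_eq_zero_iff.1 h0
    refine ⟨t - ℓ ^ n • s, ?_, ?_⟩
    · rw [smul_sub, hs, smul_smul, pow_add, mul_comm, sub_self]
    · rw [ProCompletion.eval_eq_eval_of_le (Nat.le_add_right n k) ht, map_sub, map_sub,
        map_nsmul, ProCompletion.eval_pow_nsmul, sub_zero]
  choose a ha ha' using key
  -- some torsion element occurs at infinitely many levels
  have := hfin.to_subtype
  obtain ⟨⟨b, hb⟩, hinf⟩ := Finite.exists_infinite_fiber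
    (fun n => (⟨a n, ha n⟩ : {a : A | ℓ ^ k • a = 0}))
  refine ⟨b, hb, ProCompletion.ext_eval fun m => ?_⟩
  obtain ⟨n, hn, hmn⟩ := (Set.infinite_coe_iff.1 hinf).exists_gt m
  have hab : a n = b := congrArg Subtype.val hn
  exact ProCompletion.eval_eq_eval_of_le hmn.le (hab ▸ ha' n)

theorem exists_eq_one_tmul_add (n : ℕ) (x : ℤ_[ℓ] ⊗[ℤ] A) :
    ∃ (a : A) (y : ℤ_[ℓ] ⊗[ℤ] A), x = 1 ⊗ₜ a + ℓ ^ n • y := by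
  induction x using TensorProduct.induction_on with
  | zero => exact ⟨0, 0, by simp⟩
  | add x y hx hy =>
    obtain ⟨a, x', rfl⟩ := hx
    obtain ⟨b, y', rfl⟩ := hy
    exact ⟨a + b, x' + y', by rw [TensorProduct.tmul_add, smul_add]; abel⟩
  | tmul c a =>
    obtain ⟨d, hd⟩ := Ideal.mem_span_singleton'.1 (PadicInt.appr_spec n c)
    refine ⟨c.appr n • a, d ⊗ₜ a, ?_⟩
    rw [eq_comm, TensorProduct.tmul_smul, TensorProduct.smul_tmul', TensorProduct.smul_tmul',
      ← TensorProduct.add_tmul, nsmul_eq_mul, nsmul_eq_mul, mul_one, Nat.cast_pow, mul_comm _ d, hd,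
      add_sub_cancel]

/-- Flatness of `ℤ_ℓ`: if `C` is the kernel of `g : A → ⨁ B`, then an element of `ℤ_ℓ ⊗ A` that is
killed by all the components of `g` comes from `ℤ_ℓ ⊗ C`. -/
theorem exists_baseChange_eq {ι C : Type*} [AddCommGroup C] {j : C →ₗ[ℤ] A} {g : A →ₗ[ℤ] ι →₀ B}
    (hjg : Function.Exact j g) {x : ℤ_[ℓ] ⊗[ℤ] A}
    (hx : ∀ i, (Finsupp.lapply i ∘ₗ g).baseChange ℤ_[ℓ] x = 0) :
    ∃ y : ℤ_[ℓ] ⊗[ℤ] C, j.baseChange ℤ_[ℓ] y = x := by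
  classical
  refine (Module.Flat.lTensor_exact ℤ_[ℓ] hjg x).1 ?_
  apply (TensorProduct.finsuppRight ℤ ℤ ℤ_[ℓ] B ι).injective
  rw [map_zero]
  ext i
  rw [Finsupp.zero_apply, ← hx i, LinearMap.baseChange_eq_ltensor, LinearMap.lTensor_comp,
    LinearMap.comp_apply]
  exact TensorProduct.finsuppRight_apply _ i

/-- The `ℓ ^ k`-torsion of `ℤ_ℓ ⊗ A` is the image of that of `A`. -/
theorem exists_eq_one_tmul_of_nsmul_eq_zero {k : ℕ} {x : ℤ_[ℓ] ⊗[ℤ] A} (hx : ℓ ^ k • x = 0) :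
    ∃ a : A, ℓ ^ k • a = 0 ∧ x = 1 ⊗ₜ a := by
  let f : A →ₗ[ℤ] A := (ℓ ^ k : ℤ) • LinearMap.id
  have hfa (a : A) : f a = ℓ ^ k • a := by
    rw [← natCast_zsmul, Nat.cast_pow]
    rfl
  have hf (y : ℤ_[ℓ] ⊗[ℤ] A) : f.baseChange ℤ_[ℓ] y = ℓ ^ k • y := by
    induction y using TensorProduct.induction_on with
    | zero => simp
    | add x y hx hy => rw [map_add, hx, hy, smul_add]
    | tmul c a =>
      rw [LinearMap.baseChange_tmul, TensorProduct.smul_tmul', TensorProduct.smul_tmul, hfa]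
  have hex : Function.Exact (LinearMap.ker f).subtype f := LinearMap.exact_subtype_ker_map f
  obtain ⟨y, rfl⟩ := (Module.Flat.lTensor_exact ℤ_[ℓ] hex x).1 ((hf x).trans hx)
  obtain ⟨a, z, rfl⟩ := exists_eq_one_tmul_add k y
  have hker (a : LinearMap.ker f) : ℓ ^ k • a = 0 := by
    refine Subtype.ext ?_
    rw [Submodule.coe_smul_of_tower, ← hfa]
    exact a.2
  have hz (z : ℤ_[ℓ] ⊗[ℤ] LinearMap.ker f) : ℓ ^ k • z = 0 := by
    induction z using TensorProduct.induction_on with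
    | zero => simp
    | add x y hx hy => rw [smul_add, hx, hy, add_zero]
    | tmul c a =>
      rw [TensorProduct.smul_tmul', TensorProduct.smul_tmul, hker, TensorProduct.tmul_zero]
  exact ⟨a, congrArg Subtype.val (hker a), by rw [hz, add_zero]; rfl⟩

end Completion

/-! ### Units and roots of unity in the completions of a number field -/

theorem norm_mul_sub_one_le {E : Type*} [NormedField E] [IsUltrametricDist E] {r : ℝ} (hr : r < 1)
    {a b : E} (ha : ‖a - 1‖ ≤ r) (hb : ‖b - 1‖ ≤ r) : ‖a * b - 1‖ ≤ r := by
  have ha1 : ‖a‖ ≤ 1 := by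
    rw [← sub_add_cancel a 1]
    exact (IsUltrametricDist.norm_add_le_max _ _).trans (max_le (ha.trans hr.le) norm_one.le)
  have h : a * b - 1 = a * (b - 1) + (a - 1) := by ring
  rw [h]
  refine (IsUltrametricDist.norm_add_le_max _ _).trans (max_le ?_ ha)
  rw [norm_mul]
  exact (mul_le_of_le_one_left (norm_nonneg _) ha1).trans hb

theorem norm_pow_sub_one_le {E : Type*} [NormedField E] [IsUltrametricDist E] {r : ℝ} (hr : r < 1)
    {a : E} (ha : ‖a - 1‖ ≤ r) (n : ℕ) : ‖a ^ n - 1‖ ≤ r := by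
  induction n with
  | zero => simpa using (norm_nonneg _).trans ha
  | succ n ih => exact pow_succ a n ▸ norm_mul_sub_one_le hr ih ha

/-- In a complete ultrametric field, a principal unit is an `m`-th power as soon as `m` is a unit:
Newton's map `s ↦ s - (s ^ m - y) / m` is a contraction. -/
theorem exists_pow_eq_of_norm_sub_one_lt {E : Type*} [NormedField E] [IsUltrametricDist E]
    [CompleteSpace E] {m : ℕ} (hm : ‖(m : E)‖ = 1) {y : E} (hy : ‖y - 1‖ < 1) :
    ∃ s : E, s ^ m = y := by
  have hm0 : (m : E) ≠ 0 := fun h => by simp [h] at hm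
  set r := ‖y - 1‖ with hrdef
  let S : Set E := Metric.closedBall 1 r
  have hS {s : E} : s ∈ S ↔ ‖s - 1‖ ≤ r := by rw [mem_closedBall_iff_norm]
  let T : E → E := fun s => s - (s ^ m - y) / m
  have hcon {s t : E} (hs : s ∈ S) (ht : t ∈ S) : ‖T s - T t‖ ≤ r * ‖s - t‖ := by
    have h1 : T s - T t =
        (∑ i ∈ Finset.range m, -(s ^ i * t ^ (m - 1 - i) - 1)) * (s - t) / m := by
      have h2 := (Commute.all s t).geom_sum₂_mul m
      rw [Finset.sum_neg_distrib, Finset.sum_sub_distrib, Finset.sum_const, Finset.card_range,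
        nsmul_eq_mul, mul_one, neg_sub, sub_mul, h2]
      simp only [T]
      field_simp
      ring
    rw [h1, norm_div, hm, div_one, norm_mul]
    refine mul_le_mul_of_nonneg_right ?_ (norm_nonneg _)
    refine IsUltrametricDist.norm_sum_le_of_forall_le_of_nonneg (norm_nonneg _) fun i _ => ?_
    rw [norm_neg]
    exact norm_mul_sub_one_le hy (norm_pow_sub_one_le hy (hS.1 hs) _)
      (norm_pow_sub_one_le hy (hS.1 ht) _)
  have h1S : (1 : E) ∈ S := Metric.mem_closedBall_self (norm_nonneg _)
  have hmaps : Set.MapsTo T S S := fun s hs => by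
    have h2 : T s - 1 = (T s - T 1) + (y - 1) / m := by simp only [T]; ring
    rw [hS, h2]
    refine (IsUltrametricDist.norm_add_le_max _ _).trans (max_le ?_ ?_)
    · exact (hcon hs h1S).trans
        (mul_le_of_le_one_right (norm_nonneg _) ((hS.1 hs).trans hy.le))
    · rw [norm_div, hm, div_one]
  have hcontr : ContractingWith ⟨r, norm_nonneg _⟩ (hmaps.restrict T S S) :=
    ⟨hy, LipschitzWith.of_dist_le_mul fun s t => by
      rw [Subtype.dist_eq, Subtype.dist_eq, dist_eq_norm, dist_eq_norm]
      exact hcon s.2 t.2⟩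
  obtain ⟨s, -, hs, -⟩ := ContractingWith.exists_fixedPoint' Metric.isClosed_closedBall.isComplete
    hmaps hcontr h1S (edist_ne_top _ _)
  refine ⟨s, ?_⟩
  have h3 : s - (s ^ m - y) / m = s := hs
  have h4 : (s ^ m - y) / m = 0 := by linear_combination -h3
  rw [div_eq_zero_iff, or_iff_left hm0] at h4
  exact sub_eq_zero.1 h4

theorem valuation_pow_sub_pow_lt_one {E Γ : Type*} [Field E] [LinearOrderedCommGroupWithZero Γ]
    (v : Valuation E Γ) {x y : E} (hx : v x ≤ 1) (hy : v y ≤ 1) (h : v (x - y) < 1) (n : ℕ) :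
    v (x ^ n - y ^ n) < 1 := by
  induction n with
  | zero => simp
  | succ n ih =>
    have h1 : x ^ (n + 1) - y ^ (n + 1) = x ^ n * (x - y) + (x ^ n - y ^ n) * y := by ring
    rw [h1]
    refine v.map_add_lt ?_ ?_
    · rw [map_mul, map_pow]
      exact (mul_le_of_le_one_left' (pow_le_one' hx n)).trans_lt h
    · rw [map_mul]
      exact (mul_le_of_le_one_right' hy).trans_lt ih

theorem valuation_eq_one_of_pow_eq_one {E Γ : Type*} [Field E] [LinearOrderedCommGroupWithZero Γ]
    (v : Valuation E Γ) {x : E} {n : ℕ} (hn : n ≠ 0) (hx : x ^ n = 1) : v x = 1 := by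
  have h : v x ^ n = 1 := by rw [← map_pow, hx, map_one]
  exact (pow_eq_one_iff_left hn).1 h

section Local

variable {ℓ : ℕ} [Fact ℓ.Prime] {L : Type*} [Field L] [NumberField L] (w : HeightOneSpectrum (𝓞 L))

/-- The residue field being finite, all units have a common power that is a principal unit. -/
theorem exists_valued_pow_sub_one_lt : ∃ N : ℕ, 0 < N ∧ ∀ u : w.adicCompletion L,
    Valued.v u = 1 → Valued.v (u ^ N - 1) < 1 := by
  have := w.asIdeal.finiteQuotientOfFreeOfNeBot w.ne_bot
  have := w.isMaximal
  let := Ideal.Quotient.field w.asIdeal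
  let := Fintype.ofFinite (𝓞 L ⧸ w.asIdeal)
  refine ⟨Fintype.card (𝓞 L ⧸ w.asIdeal) - 1, Nat.sub_pos_of_lt Fintype.one_lt_card, fun u hu => ?_⟩
  obtain ⟨x, hx⟩ : ∃ x : L, Valued.v (u - algebraMap L (w.adicCompletion L) x) < 1 := by
    obtain ⟨x, hx⟩ := (HeightOneSpectrum.denseRange_algebraMap L w).exists_dist_lt u one_pos
    refine ⟨x, ?_⟩
    rw [dist_eq_norm] at hx
    exact Valued.toNormedField.norm_lt_one_iff.1 hx
  have hx1 : w.valuation L x ≤ 1 := by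
    rw [← HeightOneSpectrum.valuedAdicCompletion_eq_valuation']
    have := Valued.v.map_sub_le hu.le hx.le
    rwa [sub_sub_cancel] at this
  obtain ⟨a, ha⟩ := HeightOneSpectrum.exists_valuation_sub_lt_of_integer w hx1 1
  have hua : Valued.v (u - algebraMap L (w.adicCompletion L) (a : L)) < 1 := by
    have h1 : u - algebraMap L (w.adicCompletion L) (a : L) =
        (u - algebraMap L (w.adicCompletion L) x) - algebraMap L (w.adicCompletion L) (a - x) := by
      rw [map_sub]; ring
    rw [h1]
    refine (Valued.v.map_sub _ _).trans_lt (max_lt hx ?_)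
    exact (HeightOneSpectrum.valuedAdicCompletion_eq_valuation' w _).trans_lt ha
  have hav : w.valuation L (a : L) = 1 := by
    rw [← HeightOneSpectrum.valuedAdicCompletion_eq_valuation']
    have := Valuation.map_sub_eq_of_lt_left (v := Valued.v) (hua.trans_eq hu.symm)
    rw [sub_sub_cancel] at this
    exact this.trans hu
  have haw : a ∉ w.asIdeal := (w.valuation_eq_one_iff_notMem (K := L)).1 hav
  have haN : a ^ (Fintype.card (𝓞 L ⧸ w.asIdeal) - 1) - 1 ∈ w.asIdeal := by
    rw [← Ideal.Quotient.eq_zero_iff_mem, map_sub, map_pow, map_one, sub_eq_zero]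
    exact FiniteField.pow_card_sub_one_eq_one _ (mt Ideal.Quotient.eq_zero_iff_mem.1 haw)
  generalize Fintype.card (𝓞 L ⧸ w.asIdeal) - 1 = N at haN
  rw [← sub_add_sub_cancel _ (algebraMap L (w.adicCompletion L) (a : L) ^ N)]
  refine Valued.v.map_add_lt (valuation_pow_sub_pow_lt_one _ hu.le ?_ hua N) ?_
  · exact (HeightOneSpectrum.valuedAdicCompletion_eq_valuation' w _).trans_le hav.le
  · rw [← HeightOneSpectrum.valuation_lt_one_iff_mem (K := L),
      ← HeightOneSpectrum.valuedAdicCompletion_eq_valuation] at haN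
    change Valued.v (algebraMap (𝓞 L) (w.adicCompletion L) (a ^ N - 1)) < 1 at haN
    rw [map_sub, map_pow, map_one] at haN
    exact haN

/-- The completion `L_w` contains only finitely many roots of unity of `ℓ`-power order. -/
theorem exists_not_isPrimitiveRoot : ∃ n : ℕ, ∀ ζ : w.adicCompletion L,
    ¬ IsPrimitiveRoot ζ (ℓ ^ n) := by
  obtain ⟨N, hN0, hN⟩ := exists_valued_pow_sub_one_lt w
  obtain ⟨a, b, hb, rfl⟩ := Nat.exists_eq_pow_mul_and_not_dvd hN0.ne' ℓ (Fact.out : ℓ.Prime).ne_one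
  have hℓ0 : Valued.v (ℓ : w.adicCompletion L) ≠ 0 := by
    have : CharZero (w.adicCompletion L) := algebraRat.charZero _
    rw [Ne, map_eq_zero]
    exact_mod_cast (Fact.out : ℓ.Prime).ne_zero
  obtain ⟨c, hc⟩ : ∃ c : ℕ, WithZero.exp (-(c : ℤ)) ≤ Valued.v (ℓ : w.adicCompletion L) := by
    refine ⟨(-WithZero.log (Valued.v (ℓ : w.adicCompletion L))).toNat, ?_⟩
    conv_rhs => rw [← WithZero.exp_log hℓ0]
    rw [WithZero.exp_le_exp]
    omega
  refine ⟨a + (c + 1), fun ζ hζ => ?_⟩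
  have hζ1 : Valued.v ζ = 1 := valuation_eq_one_of_pow_eq_one _
    (pow_ne_zero _ (Fact.out : ℓ.Prime).ne_zero) hζ.pow_eq_one
  -- `ζ ^ N` is still a primitive `ℓ ^ (c + 1)`-th root of unity, and it is a principal unit
  have hη : IsPrimitiveRoot (ζ ^ (ℓ ^ a * b)) (ℓ ^ (c + 1)) := by
    rw [pow_mul]
    refine (hζ.pow (pow_pos (Fact.out : ℓ.Prime).pos _) (pow_add ℓ a (c + 1))).pow_of_coprime b ?_
    exact ((Nat.Prime.coprime_iff_not_dvd Fact.out).2 hb).symm.pow_right _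
  have hprod : (ℓ : w.adicCompletion L) =
      ∏ μ ∈ primitiveRoots (ℓ ^ (c + 1)) (w.adicCompletion L), (1 - μ) := by
    rw [← Polynomial.eval_one_cyclotomic_prime_pow c,
      Polynomial.cyclotomic_eq_prod_X_sub_primitiveRoots hη, Polynomial.eval_prod]
    simp
  have hle : Valued.v (ℓ : w.adicCompletion L) ≤ WithZero.exp (-1 : ℤ) ^ (ℓ ^ (c + 1)).totient := by
    rw [hprod, map_prod, ← hη.card_primitiveRoots]
    refine Finset.prod_le_pow_card _ _ _ fun μ hμ => ?_
    obtain ⟨i, -, rfl⟩ := hη.eq_pow_of_pow_eq_one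
      (isPrimitiveRoot_of_mem_primitiveRoots hμ).pow_eq_one
    have h1 := hN (ζ ^ i) (by rw [map_pow, hζ1, one_pow])
    rw [← pow_mul, mul_comm, pow_mul, Valuation.map_sub_swap] at h1
    obtain h0 | h0 := eq_or_ne (Valued.v (1 - (ζ ^ (ℓ ^ a * b)) ^ i)) 0
    · rw [h0]; exact zero_le
    · rw [← WithZero.exp_log h0, ← WithZero.exp_zero, WithZero.exp_lt_exp] at h1
      rw [← WithZero.exp_log h0, WithZero.exp_le_exp]
      omega
  have hlt : c < (ℓ ^ (c + 1)).totient := by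
    rw [Nat.totient_prime_pow_succ Fact.out]
    exact (Nat.lt_pow_self (Fact.out : ℓ.Prime).one_lt).trans_le
      (Nat.le_mul_of_pos_right _ (Nat.sub_pos_of_lt (Fact.out : ℓ.Prime).one_lt))
  have := hc.trans hle
  rw [← WithZero.exp_nsmul, WithZero.exp_le_exp] at this
  simp at this
  omega

variable {w}

theorem valued_natCast_eq_one_iff : Valued.v (ℓ : w.adicCompletion L) = 1 ↔ ¬ IsAbove ℓ w := by
  have h : (ℓ : w.adicCompletion L) = algebraMap (𝓞 L) (w.adicCompletion L) (ℓ : 𝓞 L) :=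
    (map_natCast _ _).symm
  rw [h, IsAbove, ← HeightOneSpectrum.valuation_eq_one_iff_notMem (K := L)]
  exact (congrArg (· = 1) (HeightOneSpectrum.valuedAdicCompletion_eq_valuation w (ℓ : 𝓞 L))).to_iff

/-- At a place prime to `ℓ`, every unit is the product of a root of unity of `ℓ`-power order and of
an `ℓ ^ n`-th power. -/
theorem exists_rootOfUnity_mul_pow (hw : ¬ IsAbove ℓ w) {u : (w.adicCompletion L)ˣ}
    (hu : Valued.v (u : w.adicCompletion L) = 1) (n : ℕ) :
    ∃ ζ s : (w.adicCompletion L)ˣ, (∃ k : ℕ, ζ ^ ℓ ^ k = 1) ∧ u = ζ * s ^ ℓ ^ n := by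
  obtain ⟨N, hN0, hN⟩ := exists_valued_pow_sub_one_lt w
  obtain ⟨a, b, hb, rfl⟩ := Nat.exists_eq_pow_mul_and_not_dvd hN0.ne' ℓ (Fact.out : ℓ.Prime).ne_one
  obtain ⟨t, ht⟩ : ∃ t : w.adicCompletion L,
      t ^ ℓ ^ (n + a) = (u : w.adicCompletion L) ^ (ℓ ^ a * b) := by
    refine exists_pow_eq_of_norm_sub_one_lt ?_ (Valued.toNormedField.norm_lt_one_iff.2 (hN u hu))
    have h1 := valued_natCast_eq_one_iff.2 hw
    rw [Nat.cast_pow, norm_pow]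
    rw [le_antisymm (Valued.toNormedField.norm_le_one_iff.2 h1.le)
      (Valued.toNormedField.one_le_norm_iff.2 h1.ge), one_pow]
  have ht0 : t ≠ 0 := by
    rintro rfl
    rw [zero_pow (pow_ne_zero _ (Fact.out : ℓ.Prime).ne_zero)] at ht
    exact pow_ne_zero _ u.ne_zero ht.symm
  lift t to (w.adicCompletion L)ˣ using ht0.isUnit
  have ht' : t ^ ℓ ^ (n + a) = u ^ (ℓ ^ a * b) := Units.ext (by push_cast; exact ht)
  have hcop : IsCoprime (b : ℤ) ((ℓ ^ n : ℕ) : ℤ) :=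
    (((Nat.Prime.coprime_iff_not_dvd Fact.out).2 hb).symm.pow_right n).isCoprime
  obtain ⟨β, γ, hβγ⟩ := hcop
  refine ⟨(u ^ b / t ^ ℓ ^ n) ^ β, t ^ β * u ^ γ, ⟨a, ?_⟩, ?_⟩
  · rw [← zpow_natCast, zpow_comm, zpow_natCast, div_pow, ← pow_mul, ← pow_mul, ← pow_add, ht',
      mul_comm b, div_self', one_zpow]
  · conv_lhs => rw [← zpow_one u, ← hβγ]
    rw [div_zpow, mul_pow, ← zpow_natCast (t ^ β), zpow_comm t β, zpow_natCast,
      ← zpow_natCast (u ^ γ), ← zpow_mul, ← zpow_natCast u b, ← zpow_mul, zpow_add,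
      mul_comm β]
    rw [mul_comm (b : ℤ), ← mul_assoc, div_mul_cancel]

theorem eq_one_of_forall_exists_pow_eq {ζ : (w.adicCompletion L)ˣ} (hζ : ∃ k : ℕ, ζ ^ ℓ ^ k = 1)
    (h : ∀ n : ℕ, ∃ s, ζ = s ^ ℓ ^ n) : ζ = 1 := by
  obtain ⟨k, hk⟩ := hζ
  obtain ⟨n, hn⟩ := exists_not_isPrimitiveRoot (ℓ := ℓ) w
  obtain ⟨s, rfl⟩ := h n
  by_contra hs
  rw [← pow_mul, ← pow_add] at hk
  obtain ⟨j, -, hj⟩ := (Nat.dvd_prime_pow Fact.out).1 (orderOf_dvd_of_pow_eq_one hk)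
  have hnj : n ≤ j := by
    by_contra hlt
    exact hs (orderOf_dvd_iff_pow_eq_one.1 (hj ▸ pow_dvd_pow ℓ (not_le.1 hlt).le))
  refine hn ((s : w.adicCompletion L) ^ ℓ ^ (j - n)) ?_
  refine (IsPrimitiveRoot.coe_units_iff.2 (IsPrimitiveRoot.orderOf s)).pow (orderOf_pos_iff.2 ?_) ?_
  · exact isOfFinOrder_iff_pow_eq_one.2 ⟨_, pow_pos (Fact.out : ℓ.Prime).pos _, hk⟩
  · rw [hj, ← pow_add, Nat.sub_add_cancel hnj]

end Local

/-! ### Composita with a base extension -/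

section Compositum

variable {K L k l : Type*} [Field K] [Field L] [Field k] [Field l] [Algebra K L] [Algebra K k]
  [Algebra K l] [Algebra L l] [Algebra k l] [IsScalarTower K L l] [IsScalarTower K k l]

theorem algebraMap_mem_span_basis {ι : Type*} [Fintype ι] (b : Module.Basis ι K L) (y : L) :
    algebraMap L l y ∈ Submodule.span k (Set.range fun i => algebraMap L l (b i)) := by
  rw [← b.sum_repr y, map_sum]
  refine Submodule.sum_mem _ fun i _ => ?_
  rw [Algebra.smul_def, map_mul, ← IsScalarTower.algebraMap_apply,
    IsScalarTower.algebraMap_apply K k l, ← Algebra.smul_def]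
  exact Submodule.smul_mem _ _ (Submodule.subset_span ⟨i, rfl⟩)

variable (k l) in
theorem finiteDimensional_of_span_range_eq_top [FiniteDimensional K L]
    (h : Submodule.span k (Set.range (algebraMap L l)) = ⊤) : FiniteDimensional k l := by
  let b := Module.finBasis K L
  have h' : Submodule.span k (Set.range fun i => algebraMap L l (b i)) = ⊤ := by
    rw [eq_top_iff, ← h, Submodule.span_le]
    rintro _ ⟨y, rfl⟩
    exact algebraMap_mem_span_basis b y
  exact ⟨Submodule.fg_def.2 ⟨_, Set.finite_range _, h'⟩⟩

variable (k l) in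
theorem isGalois_of_span_range_eq_top [FiniteDimensional K L] [IsGalois K L]
    (h : Submodule.span k (Set.range (algebraMap L l)) = ⊤) : IsGalois k l := by
  obtain ⟨p, hp, hsplit⟩ := IsGalois.is_separable_splitting_field K L
  have hmap : (p.map (algebraMap K k)).map (algebraMap k l) =
      (p.map (algebraMap K L)).map (algebraMap L l) := by
    rw [Polynomial.map_map, Polynomial.map_map, ← IsScalarTower.algebraMap_eq,
      ← IsScalarTower.algebraMap_eq]
  have : (p.map (algebraMap K k)).IsSplittingField k l := by
    refine ⟨?_, ?_⟩
    · rw [hmap]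
      exact hsplit.splits.map _
    · have hroot (y : L) : algebraMap L l y ∈
          Algebra.adjoin k ((p.map (algebraMap K k)).rootSet l) := by
        have hy : y ∈ Algebra.adjoin K (p.rootSet L) := hsplit.adjoin_rootSet ▸ Algebra.mem_top
        induction hy using Algebra.adjoin_induction with
        | mem y hy =>
          refine Algebra.subset_adjoin ?_
          rw [Polynomial.mem_rootSet'] at hy ⊢
          rw [hmap, Polynomial.aeval_map_algebraMap, Polynomial.aeval_algebraMap_apply, hy.2,
            map_zero]
          exact ⟨(Polynomial.map_ne_zero_iff (algebraMap L l).injective).2 hy.1, rfl⟩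
        | algebraMap a =>
          rw [← IsScalarTower.algebraMap_apply, IsScalarTower.algebraMap_apply K k l]
          exact Subalgebra.algebraMap_mem _ _
        | add a b _ _ ha hb => rw [map_add]; exact add_mem ha hb
        | mul a b _ _ ha hb => rw [map_mul]; exact mul_mem ha hb
      rw [← Algebra.toSubmodule_eq_top, eq_top_iff, ← h, Submodule.span_le]
      rintro _ ⟨y, rfl⟩
      exact hroot y
  exact IsGalois.of_separable_splitting_field (p := p.map (algebraMap K k)) hp.map

theorem card_algEquiv_dvd_of_span_range_eq_top [FiniteDimensional K L] [IsGalois K L]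
    (h : Submodule.span k (Set.range (algebraMap L l)) = ⊤) :
    Nat.card Gal(l/k) ∣ Nat.card Gal(L/K) := by
  let r : Gal(l/k) →* Gal(L/K) := (AlgEquiv.restrictNormalHom L).comp
    (MonoidHom.mk' (AlgEquiv.restrictScalars K : Gal(l/k) → Gal(l/K)) fun _ _ => rfl)
  refine Subgroup.card_dvd_of_injective r ((injective_iff_map_eq_one r).2 fun σ hσ => ?_)
  refine AlgEquiv.ext fun x => ?_
  have hx : x ∈ Submodule.span k (Set.range (algebraMap L l)) := h ▸ Submodule.mem_top
  induction hx using Submodule.span_induction with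
  | mem x hx =>
    obtain ⟨y, rfl⟩ := hx
    have := AlgEquiv.restrictNormal_commutes (σ.restrictScalars K) L y
    exact this.symm.trans (congrArg (algebraMap L l) (DFunLike.congr_fun hσ y))
  | zero => simp
  | add x y _ _ hx hy => rw [map_add, hx, hy]; simp
  | smul a x _ hx => rw [map_smul, hx]; simp

end Compositum

/-! ### The cyclotomic `ℤ_ℓ`-extension -/

section Cyclotomic

variable {ℓ : ℕ} [Fact ℓ.Prime] {k l : Type*} [Field k] [Field l] [Algebra k l]

theorem apply_mem_cyclotomicZl (σ : Gal(AlgebraicClosure k/k)) {x : AlgebraicClosure k}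
    (hx : x ∈ cyclotomicZl ℓ k) : σ x ∈ cyclotomicZl ℓ k := by
  suffices h : cyclotomicZl ℓ k ≤ (cyclotomicZl ℓ k).comap (σ : _ →ₐ[k] _) from h hx
  refine sSup_le fun E hE => ?_
  rw [← IntermediateField.map_le_iff_le_comap]
  refine le_sSup ⟨?_, ?_⟩
  · refine (IntermediateField.map_mono _ hE.1).trans ?_
    rw [IntermediateField.adjoin_map]
    refine IntermediateField.adjoin.mono _ _ _ ?_
    rintro _ ⟨ζ, ⟨n, hn⟩, rfl⟩
    exact ⟨n, by rw [← map_pow, hn, map_one]⟩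
  · obtain ⟨m, hm⟩ := hE.2
    exact ⟨m, by rw [← hm]; exact ((IntermediateField.equivMap E _).toLinearEquiv.finrank_eq).symm⟩

/-- Being in the cyclotomic `ℤ_ℓ`-extension does not depend on the embedding in an algebraic
closure. -/
theorem algHom_apply_mem_cyclotomicZl [Algebra.IsAlgebraic k l] {φ ψ : l →ₐ[k] AlgebraicClosure k}
    {x : l} (hx : ψ x ∈ cyclotomicZl ℓ k) : φ x ∈ cyclotomicZl ℓ k := by
  have h : minpoly k (φ x) = minpoly k (ψ x) := by
    rw [minpoly.algHom_eq φ φ.injective, minpoly.algHom_eq ψ ψ.injective]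
  obtain ⟨σ, hσ⟩ := (Normal.minpoly_eq_iff_mem_orbit (AlgebraicClosure k)).1 h
  rw [← hσ]
  exact apply_mem_cyclotomicZl σ hx

theorem map_adjoin_rootsOfUnity_le_cyclotomicZl [FiniteDimensional k l] [IsGalois k l] {n : ℕ}
    (hn : Nat.card Gal(l/k) ∣ ℓ ^ n) (φ : l →ₐ[k] AlgebraicClosure k) :
    (IntermediateField.adjoin k {ζ : l | ∃ n : ℕ, ζ ^ ℓ ^ n = 1}).map φ ≤ cyclotomicZl ℓ k := by
  refine le_sSup ⟨?_, ?_⟩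
  · rw [IntermediateField.adjoin_map]
    refine IntermediateField.adjoin.mono _ _ _ ?_
    rintro _ ⟨ζ, ⟨n, hn⟩, rfl⟩
    exact ⟨n, by rw [← map_pow, hn, map_one]⟩
  · rw [IsGalois.card_aut_eq_finrank] at hn
    rw [← (IntermediateField.equivMap _ φ).toLinearEquiv.finrank_eq]
    obtain ⟨m, -, hm⟩ := (Nat.dvd_prime_pow Fact.out).1 ((Dvd.intro _ (Module.finrank_mul_finrank k
      (IntermediateField.adjoin k {ζ : l | ∃ n : ℕ, ζ ^ ℓ ^ n = 1}) l)).trans hn)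
    exact ⟨m, hm⟩

end Cyclotomic

/-! ### Completions in an extension of number fields -/

section LocalEmbedding

variable {K : Type*} [Field K] [NumberField K] {F : Type*} [Field F] [NumberField F]
  {L : Type*} [Field L] [NumberField L] [Algebra K L]
  {u : HeightOneSpectrum (𝓞 F)} {v : HeightOneSpectrum (𝓞 K)} {w : HeightOneSpectrum (𝓞 L)}

/-- A continuous homomorphism `K_v → L_w` extending `K → L`. There is at most one such, and it
exists only if `w` lies over `v`. -/
structure IsLocalEmbedding (c : v.adicCompletion K →+* w.adicCompletion L) : Prop where
  continuous : Continuous c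
  apply_algebraMap (x : K) : c (algebraMap K _ x) = algebraMap L _ (algebraMap K L x)

variable (K) in
theorem isLocalEmbedding_completionMap (w : HeightOneSpectrum (𝓞 L)) :
    IsLocalEmbedding (completionMap K w) where
  continuous := (HeightOneSpectrum.adicCompletion.continuous_ofCompletion L w).comp
    (UniformSpace.Completion.continuous_map.comp
      (HeightOneSpectrum.adicCompletion.continuous_toCompletion K _))
  apply_algebraMap := completionMap_algebraMap K w

theorem IsLocalEmbedding.comp [Algebra K F] [Algebra F L] [IsScalarTower K F L]
    {d : u.adicCompletion F →+* w.adicCompletion L} {c : v.adicCompletion K →+* u.adicCompletion F}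
    (hd : IsLocalEmbedding d) (hc : IsLocalEmbedding c) : IsLocalEmbedding (d.comp c) where
  continuous := hd.continuous.comp hc.continuous
  apply_algebraMap x := by
    rw [RingHom.comp_apply, hc.apply_algebraMap, hd.apply_algebraMap,
      ← IsScalarTower.algebraMap_apply K F L]

theorem IsLocalEmbedding.unique {c d : v.adicCompletion K →+* w.adicCompletion L}
    (hc : IsLocalEmbedding c) (hd : IsLocalEmbedding d) : c = d := by
  refine DFunLike.coe_injective ((HeightOneSpectrum.denseRange_algebraMap K v).equalizer
    hc.continuous hd.continuous (funext fun x => ?_))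
  exact (hc.apply_algebraMap x).trans (hd.apply_algebraMap x).symm

theorem IsLocalEmbedding.isScalarTower {c : v.adicCompletion K →+* w.adicCompletion L}
    (hc : IsLocalEmbedding c) :
    letI := c.toAlgebra
    IsScalarTower K (v.adicCompletion K) (w.adicCompletion L) :=
  let := c.toAlgebra
  IsScalarTower.of_algebraMap_eq fun x => by
    rw [IsScalarTower.algebraMap_apply K L (w.adicCompletion L)]
    exact (hc.apply_algebraMap x).symm

/-- `L_w = K_v L`, as the right hand side is a finite-dimensional `K_v`-subspace, hence closed, and
contains the dense subfield `L`. -/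
theorem IsLocalEmbedding.span_range_eq_top {c : v.adicCompletion K →+* w.adicCompletion L}
    (hc : IsLocalEmbedding c) :
    letI := c.toAlgebra
    Submodule.span (v.adicCompletion K) (Set.range (algebraMap L (w.adicCompletion L))) = ⊤ := by
  let := c.toAlgebra
  have := hc.isScalarTower
  let b := Module.finBasis K L
  let S := Submodule.span (v.adicCompletion K)
    (Set.range fun i => algebraMap L (w.adicCompletion L) (b i))
  have hS : IsClosed (S : Set (w.adicCompletion L)) := by
    let : NontriviallyNormedField (v.adicCompletion K) :=
      Valued.toNontriviallyNormedField (v.adicCompletion K) (WithZero (Multiplicative ℤ))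
    have : ContinuousSMul (v.adicCompletion K) (w.adicCompletion L) :=
      ⟨(hc.continuous.comp continuous_fst).mul continuous_snd⟩
    have : FiniteDimensional (v.adicCompletion K) S :=
      FiniteDimensional.span_of_finite _ (Set.finite_range _)
    exact Submodule.closed_of_finiteDimensional S
  rw [eq_top_iff]
  have hle : S ≤ Submodule.span (v.adicCompletion K)
      (Set.range (algebraMap L (w.adicCompletion L))) :=
    Submodule.span_mono (by rintro _ ⟨i, rfl⟩; exact ⟨_, rfl⟩)
  refine le_trans (fun x _ => ?_) hle
  refine hS.closure_subset_iff.2 ?_ (HeightOneSpectrum.denseRange_algebraMap L w x)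
  rintro _ ⟨y, rfl⟩
  exact algebraMap_mem_span_basis b y

end LocalEmbedding

/-! ### Localisation and local roots of unity -/

section Localization

variable {ℓ : ℕ} [Fact ℓ.Prime] {L : Type*} [Field L] [NumberField L]
  {w : HeightOneSpectrum (𝓞 L)}

theorem finite_nsmul_eq_zero_units (E : Type*) [Field E] (k : ℕ) :
    {a : Additive Eˣ | ℓ ^ k • a = 0}.Finite := by
  have : NeZero (ℓ ^ k) := ⟨pow_ne_zero _ (Fact.out : ℓ.Prime).ne_zero⟩
  have : Finite (rootsOfUnity (ℓ ^ k) E) := inferInstance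
  exact Set.toFinite (rootsOfUnity (ℓ ^ k) E : Set Eˣ)

theorem mem_localRootsOfUnity_iff_nsmul {x : LocalGroup ℓ w} :
    x ∈ localRootsOfUnity ℓ w ↔ ∃ k : ℕ, ℓ ^ k • x = 0 := by
  constructor
  · intro hx
    induction hx using Submodule.span_induction with
    | mem x hx =>
      obtain ⟨ζ, ⟨n, hn⟩, rfl⟩ := hx
      exact ⟨n, by rw [← map_nsmul, ← ofMul_pow, hn, ofMul_one, map_zero]⟩
    | zero => exact ⟨0, smul_zero _⟩
    | add x y _ _ hx hy =>
      obtain ⟨m, hm⟩ := hx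
      obtain ⟨n, hn⟩ := hy
      exact ⟨m + n, by rw [smul_add, pow_add, mul_smul, mul_smul, hn, smul_comm, hm]; simp⟩
    | smul a x _ hx =>
      obtain ⟨m, hm⟩ := hx
      exact ⟨m, by rw [smul_comm, hm, smul_zero]⟩
  · rintro ⟨k, hk⟩
    obtain ⟨a, ha, rfl⟩ :=
      ProCompletion.exists_of_eq_of_nsmul_eq_zero (finite_nsmul_eq_zero_units _ k) hk
    exact Submodule.subset_span ⟨a.toMul, ⟨k, ha⟩, rfl⟩

theorem mem_localRootsOfUnity_iff {x : LocalGroup ℓ w} :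
    x ∈ localRootsOfUnity ℓ w ↔ ∃ ζ : (w.adicCompletion L)ˣ, (∃ n : ℕ, ζ ^ ℓ ^ n = 1) ∧
      x = ProCompletion.of ℓ _ (Additive.ofMul ζ) := by
  refine ⟨fun hx => ?_, fun hx => Submodule.subset_span hx⟩
  obtain ⟨k, hk⟩ := mem_localRootsOfUnity_iff_nsmul.1 hx
  obtain ⟨a, ha, rfl⟩ :=
    ProCompletion.exists_of_eq_of_nsmul_eq_zero (finite_nsmul_eq_zero_units _ k) hk
  exact ⟨a.toMul, ⟨k, ha⟩, rfl⟩

/-- Roots of unity embed in `lim L_wˣ / (L_wˣ) ^ (ℓ ^ n)`. -/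
theorem eq_one_of_of_eq_zero {ζ : (w.adicCompletion L)ˣ} (hζ : ∃ k : ℕ, ζ ^ ℓ ^ k = 1)
    (h : ProCompletion.of ℓ _ (Additive.ofMul ζ) = 0) : ζ = 1 := by
  refine eq_one_of_forall_exists_pow_eq hζ fun n => ?_
  have h0 : ProCompletion.eval ℓ _ n (ProCompletion.of ℓ _ (Additive.ofMul ζ)) = 0 := by
    rw [h, map_zero]
  obtain ⟨s, hs⟩ := ProCompletion.eval_of_eq_zero_iff.1 h0
  exact ⟨s.toMul, hs⟩

variable (w) in
theorem localization_one_tmul (a : Additive Lˣ) :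
    localization ℓ w (1 ⊗ₜ a) = ProCompletion.of ℓ _ (unitsMap (algebraMap L _) a) := by
  rw [localization, LinearMap.liftBaseChange_tmul, one_smul]
  rfl

theorem localization_baseChange {σ : w.adicCompletion L →+* w.adicCompletion L} {τ : L →+* L}
    (h : ∀ y : L, σ (algebraMap L _ y) = algebraMap L _ (τ y)) (x : GlobalGroup ℓ L) :
    localization ℓ w ((unitsMap τ).baseChange ℤ_[ℓ] x) =
      ProCompletion.map ℓ (unitsMap σ) (localization ℓ w x) := by
  induction x using TensorProduct.induction_on with
  | zero => simp
  | add x y hx hy => simp only [map_add, hx, hy]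
  | tmul a x =>
    simp only [localization, LinearMap.baseChange_tmul, LinearMap.liftBaseChange_tmul, map_smul,
      LinearMap.comp_apply, ProCompletion.map_of]
    congr 2
    exact congrArg Additive.ofMul (Units.ext (h (x.toMul : L)).symm)

end Localization

/-! ### The pseudo-infinitesimal elements with trivial divisor -/

section Leopoldt

variable {ℓ : ℕ} [Fact ℓ.Prime] {L : Type*} [Field L] [NumberField L]

/-- The order at `w`, as a linear map. -/
noncomputable def ordHom (w : HeightOneSpectrum (𝓞 L)) : Additive Lˣ →ₗ[ℤ] ℤ :=
  AddMonoidHom.toIntLinearMap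
    { toFun := fun x => ord w x.toMul
      map_zero' := ord_one w
      map_add' := fun x y => ord_mul w x.toMul y.toMul }

variable (L) in
/-- The divisor of an element of `Lˣ`, at all the finite places. -/
noncomputable def fullDivisor : Additive Lˣ →ₗ[ℤ] HeightOneSpectrum (𝓞 L) →₀ ℤ :=
  AddMonoidHom.toIntLinearMap
    { toFun := fun x => Finsupp.ofSupportFinite (fun w => ord w x.toMul)
        (finite_ord_ne_zero L x.toMul)
      map_zero' := Finsupp.ext fun w => ord_one w
      map_add' := fun x y => Finsupp.ext fun w => ord_mul w x.toMul y.toMul }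

theorem valuation_eq_exp_neg_ord (w : HeightOneSpectrum (𝓞 L)) (x : Lˣ) :
    w.valuation L (x : L) = WithZero.exp (-ord w x) := by
  rw [← HeightOneSpectrum.valuationOfNeZero_eq, ord, neg_neg]
  rfl

theorem valued_eq_exp_neg_ord (w : HeightOneSpectrum (𝓞 L)) (x : Lˣ) :
    Valued.v (algebraMap L (w.adicCompletion L) (x : L)) = WithZero.exp (-ord w x) := by
  rw [← valuation_eq_exp_neg_ord]
  exact HeightOneSpectrum.valuedAdicCompletion_eq_valuation' w _

variable (L) in
theorem exact_unitsMap_fullDivisor :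
    Function.Exact (unitsMap (algebraMap (𝓞 L) L)) (fullDivisor L) := by
  intro x
  constructor
  · intro hx
    have hord (w : HeightOneSpectrum (𝓞 L)) : ord w x.toMul = 0 := DFunLike.congr_fun hx w
    obtain ⟨a, ha⟩ := HeightOneSpectrum.mem_integers_of_valuation_le_one L (x.toMul : L) fun w => by
      rw [valuation_eq_exp_neg_ord, hord]; simp
    obtain ⟨b, hb⟩ := HeightOneSpectrum.mem_integers_of_valuation_le_one L
      ((x.toMul⁻¹ : Lˣ) : L) fun w => by
        rw [Units.val_inv_eq_inv_val, map_inv₀, valuation_eq_exp_neg_ord, hord]; simp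
    have hab : a * b = 1 := by
      apply FaithfulSMul.algebraMap_injective (𝓞 L) L
      rw [map_mul, ha, hb, map_one, Units.mul_inv]
    exact ⟨Additive.ofMul (Units.mkOfMulEqOne a b hab), congrArg Additive.ofMul (Units.ext ha)⟩
  · rintro ⟨y, rfl⟩
    refine Finsupp.ext fun w => ?_
    have h1 : w.valuation L (algebraMap (𝓞 L) L (y.toMul : 𝓞 L)) = 1 :=
      (w.valuation_eq_one_iff_notMem (K := L)).2 fun h =>
        w.isPrime.ne_top (Ideal.eq_top_of_isUnit_mem _ h y.toMul.isUnit)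
    have h2 := valuation_eq_exp_neg_ord w (unitsMap (algebraMap (𝓞 L) L) y).toMul
    rw [show ((unitsMap (algebraMap (𝓞 L) L) y).toMul : L) =
      algebraMap (𝓞 L) L (y.toMul : 𝓞 L) from rfl, h1, ← WithZero.exp_zero, WithZero.exp_inj] at h2
    exact (neg_eq_zero.1 h2.symm)

theorem padicInt_eq_zero_of_forall_dvd {c : ℤ_[ℓ]} (h : ∀ n : ℕ, (ℓ : ℤ_[ℓ]) ^ n ∣ c) : c = 0 := by
  refine PadicInt.ext_of_toZModPow.1 fun n => ?_
  rw [map_zero, ← RingHom.mem_ker, PadicInt.ker_toZModPow]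
  exact Ideal.mem_span_singleton.2 (h n)

theorem baseChange_ordHom_eq_zero_of_mem {w : HeightOneSpectrum (𝓞 L)} {x : GlobalGroup ℓ L}
    (hx : localization ℓ w x ∈ localRootsOfUnity ℓ w) : (ordHom w).baseChange ℤ_[ℓ] x = 0 := by
  obtain ⟨k, hk⟩ := mem_localRootsOfUnity_iff_nsmul.1 hx
  apply (TensorProduct.rid ℤ ℤ_[ℓ]).injective
  rw [map_zero]
  refine padicInt_eq_zero_of_forall_dvd fun n => ?_
  obtain ⟨a, y, rfl⟩ := exists_eq_one_tmul_add (n + k) x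
  have h0 : ProCompletion.eval ℓ _ (n + k)
      (ProCompletion.of ℓ _ (ℓ ^ k • unitsMap (algebraMap L (w.adicCompletion L)) a)) = 0 := by
    have h1 := congrArg (ProCompletion.eval ℓ _ (n + k)) hk
    rwa [map_add, smul_add, map_add, map_nsmul (localization ℓ w), smul_comm,
      ProCompletion.eval_pow_nsmul, add_zero, localization_one_tmul, ← map_nsmul, map_zero] at h1
  obtain ⟨b, hb⟩ := ProCompletion.eval_of_eq_zero_iff.1 h0
  have hb' : (algebraMap L (w.adicCompletion L) (a.toMul : L)) ^ ℓ ^ k =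
      ((b.toMul : (w.adicCompletion L)ˣ) : w.adicCompletion L) ^ ℓ ^ (n + k) :=
    congrArg (fun z : Additive (w.adicCompletion L)ˣ => (z.toMul : w.adicCompletion L)) hb
  have hb0 : Valued.v ((b.toMul : (w.adicCompletion L)ˣ) : w.adicCompletion L) ≠ 0 :=
    (map_ne_zero _).2 b.toMul.ne_zero
  have h2 := congrArg (Valued.v (R := w.adicCompletion L)) hb'
  rw [map_pow, map_pow, valued_eq_exp_neg_ord, ← WithZero.exp_log hb0, ← WithZero.exp_nsmul,
    ← WithZero.exp_nsmul, WithZero.exp_inj] at h2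
  set z := WithZero.log (Valued.v ((b.toMul : (w.adicCompletion L)ˣ) : w.adicCompletion L))
  have h3 : ord w a.toMul = ℓ ^ n * -z := by
    have hℓ : (ℓ : ℤ) ^ k ≠ 0 := pow_ne_zero _ (by exact_mod_cast (Fact.out : ℓ.Prime).ne_zero)
    refine mul_left_cancel₀ hℓ ?_
    simp only [nsmul_eq_mul, pow_add] at h2
    push_cast at h2
    linear_combination -h2
  rw [map_add, map_add, map_nsmul, map_nsmul, LinearMap.baseChange_tmul, TensorProduct.rid_tmul]
  refine dvd_add ?_ ?_
  · rw [show ordHom w a = ord w a.toMul from rfl, h3, zsmul_eq_mul, mul_one]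
    push_cast
    exact dvd_mul_right _ _
  · rw [nsmul_eq_mul, pow_add]
    push_cast
    rw [mul_assoc]
    exact dvd_mul_right _ _

theorem rid_baseChange_ordHom (w : {w : HeightOneSpectrum (𝓞 L) // ¬ IsAbove ℓ w})
    (x : GlobalGroup ℓ L) :
    TensorProduct.rid ℤ ℤ_[ℓ] ((ordHom w.1).baseChange ℤ_[ℓ] x) = divisor ℓ L x w := by
  induction x using TensorProduct.induction_on with
  | zero => simp
  | add x y hx hy => rw [map_add, map_add, map_add, hx, hy, Finsupp.add_apply]
  | tmul a x =>
    rw [divisor, LinearMap.baseChange_tmul, TensorProduct.rid_tmul, LinearMap.liftBaseChange_tmul,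
      zsmul_eq_mul, mul_comm]
    rfl

/-- Under the Leopoldt conjecture, the only pseudo-infinitesimal elements with trivial divisor are
the global roots of unity. -/
theorem exists_rootOfUnity_of_divisor_eq_zero (hL : Leopoldt ℓ L) {x : GlobalGroup ℓ L}
    (hx : x ∈ pseudoInfinitesimals ℓ L) (hdiv : divisor ℓ L x = 0) :
    ∃ ζ : Lˣ, (∃ k : ℕ, ζ ^ ℓ ^ k = 1) ∧ x = 1 ⊗ₜ Additive.ofMul ζ := by
  simp only [pseudoInfinitesimals, Submodule.mem_iInf, Submodule.mem_comap] at hx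
  obtain ⟨y, rfl⟩ : ∃ y, (unitsMap (algebraMap (𝓞 L) L)).baseChange ℤ_[ℓ] y = x := by
    refine exists_baseChange_eq (exact_unitsMap_fullDivisor L) fun w => ?_
    change (ordHom w).baseChange ℤ_[ℓ] x = 0
    by_cases hw : IsAbove ℓ w
    · exact baseChange_ordHom_eq_zero_of_mem (hx w hw)
    · apply (TensorProduct.rid ℤ ℤ_[ℓ]).injective
      rw [rid_baseChange_ordHom ⟨w, hw⟩, hdiv, map_zero, Finsupp.zero_apply]
  have hfin : Finite {w : HeightOneSpectrum (𝓞 L) // IsAbove ℓ w} := by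
    have hℓ : Ideal.span {(ℓ : 𝓞 L)} ≠ 0 := by
      rw [Ne, Ideal.zero_eq_bot, Ideal.span_singleton_eq_bot]
      exact_mod_cast (Fact.out : ℓ.Prime).ne_zero
    refine ((Ideal.finite_factors hℓ).subset fun w hw => ?_).to_subtype
    exact Ideal.dvd_iff_le.2 ((Ideal.span_singleton_le_iff_mem _).2 hw)
  have hk (w : {w : HeightOneSpectrum (𝓞 L) // IsAbove ℓ w}) :=
    mem_localRootsOfUnity_iff_nsmul.1 (hx w.1 w.2)
  choose k hk using hk
  obtain ⟨m, hm⟩ := (Set.finite_range k).bddAbove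
  have hy : ℓ ^ m • y = 0 := by
    refine hL ?_
    rw [map_zero]
    refine funext fun w => ?_
    have hkm : k w ≤ m := hm ⟨w, rfl⟩
    rw [map_nsmul]
    change ℓ ^ m • localization ℓ w.1 _ = 0
    rw [← Nat.sub_add_cancel hkm, pow_add, mul_smul, hk, smul_zero]
  obtain ⟨ζ, hζ, h⟩ := exists_eq_one_tmul_of_nsmul_eq_zero (k := m)
    (x := (unitsMap (algebraMap (𝓞 L) L)).baseChange ℤ_[ℓ] y) (by rw [← map_nsmul, hy, map_zero])
  exact ⟨ζ.toMul, ⟨m, hζ⟩, h⟩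

end Leopoldt

/-! ### Towers of number fields -/

section Tower

variable {ℓ : ℕ} [Fact ℓ.Prime] {K : Type*} [Field K] [NumberField K] {F : Type*} [Field F]
  [NumberField F] {L : Type*} [Field L] [NumberField L] [Algebra K F] [Algebra F L] [Algebra K L]

theorem extendDivisor_extendDivisor [IsScalarTower K F L] (D : Divisors ℓ K) :
    extendDivisor ℓ F L (extendDivisor ℓ K F D) = extendDivisor ℓ K L D := by
  refine Finsupp.ext fun w => ?_
  have hw : placeBelow ℓ K (placeBelow ℓ F w) = placeBelow ℓ K w :=
    Subtype.ext (HeightOneSpectrum.ext (Ideal.under_under (B := 𝓞 F) w.1.asIdeal))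
  have he := Ideal.ramificationIdx_tower (R := 𝓞 K) (w.1.under (𝓞 F)).asIdeal w.1.asIdeal
  change (w.1.asIdeal.ramificationIdx (𝓞 F) : ℤ_[ℓ]) *
    (((w.1.under (𝓞 F)).asIdeal.ramificationIdx (𝓞 K) : ℤ_[ℓ]) *
      D (placeBelow ℓ K (placeBelow ℓ F w))) =
    (w.1.asIdeal.ramificationIdx (𝓞 K) : ℤ_[ℓ]) * D (placeBelow ℓ K w)
  rw [hw, he]
  push_cast
  ring

variable (L) in
theorem exists_under_eq (w : HeightOneSpectrum (𝓞 F)) :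
    ∃ W : HeightOneSpectrum (𝓞 L), W.under (𝓞 F) = w := by
  have := w.isPrime
  obtain ⟨Q, -, hQ, hQw⟩ := Ideal.exists_ideal_over_prime_of_isIntegral (S := 𝓞 L) w.asIdeal ⊥ (by
    rw [Ideal.comap_bot_of_injective _ (FaithfulSMul.algebraMap_injective (𝓞 F) (𝓞 L))]
    exact bot_le)
  refine ⟨⟨Q, hQ, ?_⟩, HeightOneSpectrum.ext hQw⟩
  rintro rfl
  rw [Ideal.comap_bot_of_injective _ (FaithfulSMul.algebraMap_injective (𝓞 F) (𝓞 L))] at hQw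
  exact w.ne_bot hQw.symm

theorem extendDivisor_injective : Function.Injective (extendDivisor ℓ F L) := by
  refine (injective_iff_map_eq_zero _).2 fun D hD => Finsupp.ext fun v => ?_
  obtain ⟨W, hW⟩ := exists_under_eq L v.1
  have hWℓ : ¬ IsAbove ℓ W := fun h => v.2 (hW ▸ (isAbove_under ℓ F W).2 h)
  have h : (W.asIdeal.ramificationIdx (𝓞 F) : ℤ_[ℓ]) * D (placeBelow ℓ F ⟨W, hWℓ⟩) = 0 :=
    DFunLike.congr_fun hD (⟨W, hWℓ⟩ : {w : HeightOneSpectrum (𝓞 L) // ¬ IsAbove ℓ w})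
  have hv : placeBelow ℓ F ⟨W, hWℓ⟩ = v := Subtype.ext hW
  rw [hv] at h
  refine (mul_eq_zero.1 h).resolve_left ?_
  have := W.isPrime
  exact_mod_cast (Ideal.ramificationIdx_pos (R := 𝓞 F) W.asIdeal).ne'

theorem extendGlobal_mem_pseudoInfinitesimals {x : GlobalGroup ℓ F}
    (hx : x ∈ pseudoInfinitesimals ℓ F) : extendGlobal ℓ F L x ∈ pseudoInfinitesimals ℓ L := by
  simp only [pseudoInfinitesimals, Submodule.mem_iInf, Submodule.mem_comap] at hx ⊢
  intro w hw
  rw [localization_extendGlobal]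
  exact map_localRootsOfUnity ℓ F w ⟨_, hx _ ((isAbove_under ℓ F w).2 hw), rfl⟩

/-- Being pseudo-infinitesimal can be checked after an extension of scalars: taking norms, an
element of `ℛ_{F_w}` is torsion as soon as its image in `ℛ_{L_W}` is. -/
theorem mem_pseudoInfinitesimals_of_extendGlobal_mem {x : GlobalGroup ℓ F}
    (hx : extendGlobal ℓ F L x ∈ pseudoInfinitesimals ℓ L) : x ∈ pseudoInfinitesimals ℓ F := by
  simp only [pseudoInfinitesimals, Submodule.mem_iInf, Submodule.mem_comap] at hx ⊢
  intro w hw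
  obtain ⟨W, rfl⟩ := exists_under_eq L w
  obtain ⟨k, hk⟩ := mem_localRootsOfUnity_iff_nsmul.1 (hx W ((isAbove_under ℓ F W).1 hw))
  rw [localization_extendGlobal] at hk
  let c := completionMap F W
  have hc := isLocalEmbedding_completionMap F W
  let := c.toAlgebra
  have := hc.isScalarTower
  have := finiteDimensional_of_span_range_eq_top (K := F) (L := L) _ _ hc.span_range_eq_top
  let d := Module.finrank ((W.under (𝓞 F)).adicCompletion F) (W.adicCompletion L)
  have hd : d ≠ 0 := Module.finrank_pos.ne'
  let N : Additive (W.adicCompletion L)ˣ →ₗ[ℤ] Additive ((W.under (𝓞 F)).adicCompletion F)ˣ :=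
    (MonoidHom.toAdditive
      (Units.map (Algebra.norm ((W.under (𝓞 F)).adicCompletion F)))).toIntLinearMap
  have hN (y : Additive ((W.under (𝓞 F)).adicCompletion F)ˣ) : N (unitsMap c y) = d • y :=
    congrArg Additive.ofMul (Units.ext (Algebra.norm_algebraMap
      ((y.toMul : ((W.under (𝓞 F)).adicCompletion F)ˣ) : (W.under (𝓞 F)).adicCompletion F)))
  have h0 := congrArg (ProCompletion.map ℓ N) hk
  rw [map_nsmul, map_zero, ProCompletion.map_map_eq_nsmul hN, smul_smul] at h0
  exact mem_localRootsOfUnity_iff_nsmul.2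
    (exists_pow_nsmul_eq_zero (mul_ne_zero (pow_ne_zero _ (Fact.out : ℓ.Prime).ne_zero) hd) h0)

theorem mk_mem_capitulation_iff {D : Divisors ℓ K} :
    Submodule.Quotient.mk D ∈ capitulation ℓ K L ↔
      ∃ x ∈ pseudoInfinitesimals ℓ L, divisor ℓ L x = extendDivisor ℓ K L D := by
  rw [capitulation, LinearMap.mem_ker]
  exact Submodule.Quotient.mk_eq_zero _

/-- The action of `Gal(L/K)` preserves the pseudo-infinitesimal elements, and those whose divisor
is extended from `K`. -/
theorem galois_action_pseudoInfinitesimals (σ : Gal(L/K)) {x : GlobalGroup ℓ L} {D : Divisors ℓ K}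
    (hx : x ∈ pseudoInfinitesimals ℓ L) (hdiv : divisor ℓ L x = extendDivisor ℓ K L D) :
    (unitsMap (σ : L →+* L)).baseChange ℤ_[ℓ] x ∈ pseudoInfinitesimals ℓ L ∧
      divisor ℓ L ((unitsMap (σ : L →+* L)).baseChange ℤ_[ℓ] x) = extendDivisor ℓ K L D := by
  -- view `L` as an extension of itself by means of `σ`
  let inst : Algebra L L := (σ : L →+* L).toAlgebra
  have tower : @IsScalarTower K L L _ inst.toSMul _ :=
    @IsScalarTower.of_algebraMap_eq K L L _ _ _ _ inst _ fun r => (σ.commutes r).symm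
  constructor
  · exact @extendGlobal_mem_pseudoInfinitesimals ℓ _ L _ _ L _ _ inst x hx
  · refine (@divisor_extendGlobal ℓ _ L _ _ L _ _ inst x).trans ?_
    rw [hdiv]
    exact @extendDivisor_extendDivisor ℓ _ K _ _ L _ _ L _ _ _ inst _ tower D

end Tower

/-! ### The Galois action on `ℛ_L` -/

section GaloisAction

variable {ℓ : ℕ} [Fact ℓ.Prime] {K : Type*} [Field K] {L : Type*} [Field L] [NumberField L]
  [Algebra K L]

/-- The action of `Gal(L/K)` on `ℛ_L`. -/
noncomputable def galoisAction (σ : Gal(L/K)) : GlobalGroup ℓ L →ₗ[ℤ_[ℓ]] GlobalGroup ℓ L :=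
  (unitsMap (σ : L →+* L)).baseChange ℤ_[ℓ]

theorem galoisAction_mul (σ τ : Gal(L/K)) (x : GlobalGroup ℓ L) :
    galoisAction (σ * τ) x = galoisAction σ (galoisAction τ x) := by
  rw [galoisAction, galoisAction, galoisAction, ← LinearMap.comp_apply, ← LinearMap.baseChange_comp]
  rfl

theorem galoisAction_one (x : GlobalGroup ℓ L) : galoisAction (1 : Gal(L/K)) x = x := by
  change LinearMap.baseChange ℤ_[ℓ] LinearMap.id x = x
  rw [LinearMap.baseChange_id, LinearMap.id_apply]

variable (K) in
/-- The subgroup of `Gal(L/K)` that fixes an element of `ℛ_L`. -/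
def globalStabilizer (x : GlobalGroup ℓ L) : Subgroup Gal(L/K) where
  carrier := {σ | galoisAction σ x = x}
  mul_mem' {σ τ} hσ hτ := by
    rw [Set.mem_ofPred_eq] at *
    rw [galoisAction_mul, hτ, hσ]
  one_mem' := galoisAction_one x
  inv_mem' {σ} hσ := by
    rw [Set.mem_ofPred_eq] at *
    conv_lhs => rw [← hσ]
    rw [← galoisAction_mul, inv_mul_cancel, galoisAction_one]

theorem mem_globalStabilizer {x : GlobalGroup ℓ L} {σ : Gal(L/K)} :
    σ ∈ globalStabilizer K x ↔ galoisAction σ x = x := Iff.rfl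

/-- `ℛ_F` is the group of invariants of `Gal(L/F)` in `ℛ_L`. -/
theorem exists_extendGlobal_eq {F : Type*} [Field F] [NumberField F] [Algebra F L] [IsGalois F L]
    {x : GlobalGroup ℓ L} (hx : ∀ σ : Gal(L/F), galoisAction σ x = x) :
    ∃ y : GlobalGroup ℓ F, extendGlobal ℓ F L y = x := by
  let g : Additive Lˣ →ₗ[ℤ] Gal(L/F) →₀ Additive Lˣ :=
    (Finsupp.linearEquivFunOnFinite ℤ (Additive Lˣ) Gal(L/F)).symm.toLinearMap ∘ₗ
      LinearMap.pi fun σ => unitsMap (σ : L →+* L) - LinearMap.id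
  have hg (a : Additive Lˣ) (σ : Gal(L/F)) : g a σ = unitsMap (σ : L →+* L) a - a := rfl
  refine exists_baseChange_eq (j := unitsMap (algebraMap F L)) (g := g) (fun a => ?_) fun σ => ?_
  · constructor
    · intro ha
      have hfix (σ : Gal(L/F)) : σ (a.toMul : L) = a.toMul := by
        have := DFunLike.congr_fun ha σ
        rw [hg, Finsupp.zero_apply, sub_eq_zero] at this
        exact congrArg (fun z : Additive Lˣ => (z.toMul : L)) this
      obtain ⟨b, hb⟩ := (IsGalois.mem_range_algebraMap_iff_fixed (F := F) (a.toMul : L)).2 hfix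
      have hb0 : b ≠ 0 := by
        rintro rfl
        exact a.toMul.ne_zero (hb.symm.trans (map_zero _))
      exact ⟨Additive.ofMul (Units.mk0 b hb0), congrArg Additive.ofMul (Units.ext hb)⟩
    · rintro ⟨b, rfl⟩
      refine Finsupp.ext fun σ => ?_
      rw [hg, Finsupp.zero_apply, sub_eq_zero]
      exact congrArg Additive.ofMul (Units.ext (σ.commutes (b.toMul : F)))
  · have h : Finsupp.lapply σ ∘ₗ g = unitsMap (σ : L →+* L) - LinearMap.id := rfl
    rw [h, LinearMap.baseChange_sub, LinearMap.sub_apply, LinearMap.baseChange_id,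
      LinearMap.id_apply, sub_eq_zero]
    exact hx σ

end GaloisAction

/-! ### Locally cyclotomic subextensions -/

section LocallyCyclotomic

variable {ℓ : ℕ} [Fact ℓ.Prime] {K : Type*} [Field K] [NumberField K]
  {L : Type*} [Field L] [NumberField L] [Algebra K L]

theorem under_under_eq (F : IntermediateField K L) (W : HeightOneSpectrum (𝓞 L)) :
    (W.under (𝓞 F)).under (𝓞 K) = W.under (𝓞 K) :=
  HeightOneSpectrum.ext (Ideal.under_under (B := 𝓞 F) W.asIdeal)

theorem IsLocallyCyclotomic.apply_mem_cyclotomicZl {F : IntermediateField K L}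
    (hF : IsLocallyCyclotomic ℓ K F) {W : HeightOneSpectrum (𝓞 L)} {v : HeightOneSpectrum (𝓞 K)}
    (hv : v = W.under (𝓞 K)) {c : v.adicCompletion K →+* W.adicCompletion L}
    (hc : IsLocalEmbedding c) {φ : W.adicCompletion L →+* AlgebraicClosure (v.adicCompletion K)}
    (hφ : φ.comp c = algebraMap _ _) {y : L} (hy : y ∈ F) :
    φ (algebraMap L _ y) ∈ cyclotomicZl ℓ (v.adicCompletion K) := by
  obtain rfl : v = (W.under (𝓞 F)).under (𝓞 K) := hv.trans (under_under_eq F W).symm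
  have hd := isLocalEmbedding_completionMap (K := F) W
  have he := isLocalEmbedding_completionMap K (W.under (𝓞 F))
  obtain rfl := hc.unique (hd.comp he)
  obtain ⟨f, hf⟩ := hF.1 (W.under (𝓞 F))
  let := (completionMap K (W.under (𝓞 F))).toAlgebra
  have := he.isScalarTower
  have := finiteDimensional_of_span_range_eq_top (K := K) (L := F) _ _ he.span_range_eq_top
  let φ' : (W.under (𝓞 F)).adicCompletion F →ₐ[((W.under (𝓞 F)).under (𝓞 K)).adicCompletion K]
      AlgebraicClosure (((W.under (𝓞 F)).under (𝓞 K)).adicCompletion K) :=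
    { φ.comp (completionMap F W) with commutes' := fun a => DFunLike.congr_fun hφ a }
  let ψ : (W.under (𝓞 F)).adicCompletion F →ₐ[((W.under (𝓞 F)).under (𝓞 K)).adicCompletion K]
      AlgebraicClosure (((W.under (𝓞 F)).under (𝓞 K)).adicCompletion K) :=
    { (algebraMap (cyclotomicZl ℓ (((W.under (𝓞 F)).under (𝓞 K)).adicCompletion K)) _).comp f with
      commutes' := fun a => congrArg Subtype.val (DFunLike.congr_fun hf a) }
  have h : φ' (algebraMap F _ ⟨y, hy⟩) ∈ cyclotomicZl ℓ _ :=
    algHom_apply_mem_cyclotomicZl (ψ := ψ) (f (algebraMap F _ ⟨y, hy⟩)).2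
  have hy' : φ' (algebraMap F _ ⟨y, hy⟩) = φ (algebraMap L _ y) :=
    congrArg φ (hd.apply_algebraMap ⟨y, hy⟩)
  exact hy' ▸ h

/-- A criterion for a subextension to be locally cyclotomic: by density, it is enough to control
the elements of the global field in an embedding of each `L_W` in an algebraic closure. -/
theorem isLocallyCyclotomic_of_forall_apply_mem [IsGalois K L] (hodd : Odd (Nat.card Gal(L/K)))
    {F : IntermediateField K L}
    (h : ∀ (W : HeightOneSpectrum (𝓞 L)) (v : HeightOneSpectrum (𝓞 K)), v = W.under (𝓞 K) →
      ∀ c : v.adicCompletion K →+* W.adicCompletion L, IsLocalEmbedding c →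
      ∀ φ : W.adicCompletion L →+* AlgebraicClosure (v.adicCompletion K),
        φ.comp c = algebraMap _ _ →
      ∀ y ∈ F, φ (algebraMap L _ y) ∈ cyclotomicZl ℓ (v.adicCompletion K)) :
    IsLocallyCyclotomic ℓ K F := by
  refine ⟨fun w => ?_, ?_⟩
  · obtain ⟨W, rfl⟩ := exists_under_eq L w
    have hd := isLocalEmbedding_completionMap (K := F) W
    have he := isLocalEmbedding_completionMap K (W.under (𝓞 F))
    have hc := hd.comp he
    obtain ⟨φ, hφ⟩ : ∃ φ : W.adicCompletion L →+*
        AlgebraicClosure (((W.under (𝓞 F)).under (𝓞 K)).adicCompletion K),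
        φ.comp ((completionMap F W).comp (completionMap K (W.under (𝓞 F)))) = algebraMap _ _ := by
      let := ((completionMap F W).comp (completionMap K (W.under (𝓞 F)))).toAlgebra
      have := hc.isScalarTower
      have := finiteDimensional_of_span_range_eq_top (K := K) (L := L) _ _ hc.span_range_eq_top
      let φ : W.adicCompletion L →ₐ[((W.under (𝓞 F)).under (𝓞 K)).adicCompletion K]
        AlgebraicClosure (((W.under (𝓞 F)).under (𝓞 K)).adicCompletion K) := IsAlgClosed.lift
      exact ⟨φ, φ.comp_algebraMap⟩
    have hF := h W _ (under_under_eq F W) _ hc φ hφ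
    have hmem (y : (W.under (𝓞 F)).adicCompletion F) :
        φ (completionMap F W y) ∈
          cyclotomicZl ℓ (((W.under (𝓞 F)).under (𝓞 K)).adicCompletion K) := by
      let := (completionMap K (W.under (𝓞 F))).toAlgebra
      have hy : y ∈ Submodule.span (((W.under (𝓞 F)).under (𝓞 K)).adicCompletion K)
          (Set.range (algebraMap F ((W.under (𝓞 F)).adicCompletion F))) := by
        rw [he.span_range_eq_top]; exact Submodule.mem_top
      induction hy using Submodule.span_induction with
      | mem y hy =>
        obtain ⟨z, rfl⟩ := hy
        rw [hd.apply_algebraMap]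
        exact hF _ z.2
      | zero => simp
      | add a b _ _ ha hb => rw [map_add, map_add]; exact add_mem ha hb
      | smul a b _ hb =>
        rw [Algebra.smul_def, map_mul, map_mul]
        refine mul_mem ?_ hb
        have ha : φ (completionMap F W (algebraMap _ _ a)) = algebraMap _ _ a :=
          DFunLike.congr_fun hφ a
        rw [ha]
        exact IntermediateField.algebraMap_mem _ _
    refine ⟨(φ.comp (completionMap F W)).codRestrict _ hmem, ?_⟩
    exact RingHom.ext fun a => Subtype.ext (DFunLike.congr_fun hφ a)
  · have := IsUnramifiedAtInfinitePlaces_of_odd_card_aut hodd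
    exact IsUnramifiedAtInfinitePlaces.bot K F L

/-- The compositum of the locally cyclotomic subextensions is locally cyclotomic. -/
theorem isLocallyCyclotomic_maxLocallyCyclotomic [IsGalois K L] (hodd : Odd (Nat.card Gal(L/K))) :
    IsLocallyCyclotomic ℓ K (maxLocallyCyclotomic ℓ K L) := by
  refine isLocallyCyclotomic_of_forall_apply_mem hodd fun W v hv c hc φ hφ y hy => ?_
  let := c.toAlgebra
  have := hc.isScalarTower
  let ψ : L →ₐ[K] AlgebraicClosure (v.adicCompletion K) :=
    { φ.comp (algebraMap L _) with
      commutes' := fun a => by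
        change φ (algebraMap L _ (algebraMap K L a)) = _
        rw [← hc.apply_algebraMap, IsScalarTower.algebraMap_apply K (v.adicCompletion K)]
        exact DFunLike.congr_fun hφ _ }
  have hle : maxLocallyCyclotomic ℓ K L ≤
      ((cyclotomicZl ℓ (v.adicCompletion K)).restrictScalars K).comap ψ :=
    sSup_le fun F hF z hz => hF.apply_mem_cyclotomicZl hv hc hφ hz
  exact hle hy

end LocallyCyclotomic

/-! ### Capitulation and locally cyclotomic extensions -/

section Capitulation

variable {ℓ : ℕ} [Fact ℓ.Prime] {K : Type*} [Field K] [NumberField K]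
  {L : Type*} [Field L] [NumberField L] [Algebra K L]

theorem exists_ord_eq (v : HeightOneSpectrum (𝓞 K)) (m : ℤ) : ∃ t : Kˣ, ord v t = m := by
  obtain ⟨t, ht⟩ := v.valuation_surjective K (WithZero.exp (-m))
  have ht0 : t ≠ 0 := by
    rintro rfl
    rw [map_zero] at ht
    exact WithZero.exp_ne_zero ht.symm
  refine ⟨Units.mk0 t ht0, ?_⟩
  have h := valuation_eq_exp_neg_ord v (Units.mk0 t ht0)
  rw [Units.val_mk0, ht, WithZero.exp_inj] at h
  exact neg_injective h.symm

/-- If the divisor of a pseudo-infinitesimal element of `ℛ_L` is extended from `K`, then, modulo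
`ℓ ^ n`, the element is locally everywhere the product of an element of `Kˣ` and of a local root
of unity. -/
theorem exists_eval_localization_eq {x : GlobalGroup ℓ L} {D : Divisors ℓ K}
    (hx : x ∈ pseudoInfinitesimals ℓ L) (hdiv : divisor ℓ L x = extendDivisor ℓ K L D)
    (w : HeightOneSpectrum (𝓞 L)) (n : ℕ) :
    ∃ (z : Kˣ) (ζ : (w.adicCompletion L)ˣ), (∃ k : ℕ, ζ ^ ℓ ^ k = 1) ∧
      ProCompletion.eval ℓ _ n (localization ℓ w x) = ProCompletion.eval ℓ _ n
        (ProCompletion.of ℓ _ (Additive.ofMul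
          (Units.map (algebraMap L (w.adicCompletion L) : L →* w.adicCompletion L)
            (Units.map (algebraMap K L : K →* L) z) * ζ))) := by
  by_cases hw : IsAbove ℓ w
  · simp only [pseudoInfinitesimals, Submodule.mem_iInf, Submodule.mem_comap] at hx
    obtain ⟨ζ, hζ, h⟩ := mem_localRootsOfUnity_iff.1 (hx w hw)
    exact ⟨1, ζ, hζ, by rw [h, map_one, map_one, one_mul]⟩
  obtain ⟨a, y, rfl⟩ := exists_eq_one_tmul_add n x
  set δ : ℤ_[ℓ] := D (placeBelow ℓ K ⟨w, hw⟩)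
  obtain ⟨z, hz⟩ := exists_ord_eq (w.under (𝓞 K)) (δ.appr n : ℤ)
  obtain ⟨δ', hδ'⟩ := Ideal.mem_span_singleton'.1 (PadicInt.appr_spec n δ)
  -- the divisor of `x` at `w` is known modulo `ℓ ^ n` from `a` and from `z`
  have hmod : (ℓ : ℤ) ^ n ∣ ord w a.toMul - ord w (Units.map (algebraMap K L : K →* L) z) := by
    rw [ord_extend, hz]
    have h1 : ((ord w a.toMul : ℤ) : ℤ_[ℓ]) + ℓ ^ n * divisor ℓ L y ⟨w, hw⟩ =
        (w.asIdeal.ramificationIdx (𝓞 K) : ℤ_[ℓ]) * δ := by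
      have h2 : divisor ℓ L (1 ⊗ₜ a + ℓ ^ n • y) ⟨w, hw⟩ =
          extendDivisor ℓ K L D ⟨w, hw⟩ := by rw [hdiv]
      rw [map_add, map_nsmul, Finsupp.add_apply, Finsupp.smul_apply, nsmul_eq_mul, divisor,
        LinearMap.liftBaseChange_tmul, one_smul, ← divisor, Nat.cast_pow] at h2
      exact h2
    have h3 : ((ℓ : ℤ_[ℓ]) ^ n) ∣ ((ord w a.toMul -
        w.asIdeal.ramificationIdx (𝓞 K) * (δ.appr n : ℤ) : ℤ) : ℤ_[ℓ]) := by
      refine ⟨w.asIdeal.ramificationIdx (𝓞 K) * δ' - divisor ℓ L y ⟨w, hw⟩, ?_⟩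
      push_cast
      linear_combination h1 - (w.asIdeal.ramificationIdx (𝓞 K) : ℤ_[ℓ]) * hδ'
    exact (PadicInt.pow_p_dvd_int_iff _ _).1 h3
  obtain ⟨q, hq⟩ := hmod
  obtain ⟨t, ht⟩ := exists_ord_eq w q
  let i : Lˣ →* (w.adicCompletion L)ˣ :=
    Units.map (algebraMap L (w.adicCompletion L) : L →* w.adicCompletion L)
  let z' : Lˣ := Units.map (algebraMap K L : K →* L) z
  let u : Lˣ := a.toMul * (z' * t ^ ℓ ^ n)⁻¹
  have hu : ord w u = 0 := by
    have h1 : ordHom w (Additive.ofMul u) =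
        ord w a.toMul - (ord w z' + ℓ ^ n * ord w t) := by
      change ordHom w (a - (Additive.ofMul z' + ℓ ^ n • Additive.ofMul t)) = _
      rw [map_sub, map_add, map_nsmul, nsmul_eq_mul]
      push_cast
      rfl
    change ordHom w (Additive.ofMul u) = 0
    rw [h1, ht]
    linear_combination hq
  obtain ⟨ζ, s, hζ, hs⟩ := exists_rootOfUnity_mul_pow hw (u := i u) (by
    refine (valued_eq_exp_neg_ord w u).trans ?_
    rw [hu]; simp) n
  refine ⟨z, ζ, hζ, ?_⟩
  have ha : Additive.ofMul (i a.toMul) =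
      Additive.ofMul (i z' * ζ) + ℓ ^ n • Additive.ofMul (i t * s) := by
    rw [← ofMul_pow, ← ofMul_mul, mul_pow, mul_mul_mul_comm, ← hs]
    congr 1
    rw [← map_pow, ← map_mul, ← map_mul]
    congr 1
    simp only [u]
    rw [mul_comm, inv_mul_cancel_right]
  rw [map_add, map_nsmul, map_add, ProCompletion.eval_pow_nsmul, add_zero, localization_one_tmul]
  change ProCompletion.eval ℓ _ n (ProCompletion.of ℓ _ (Additive.ofMul (i a.toMul))) = _
  rw [ha, map_add, map_add, map_nsmul, ProCompletion.eval_pow_nsmul, add_zero]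

/-- The element `σ x / x` of `ℛ_L` is a root of unity when the pseudo-infinitesimal element `x` has
its divisor extended from `K`. -/
theorem exists_galoisAction_eq (hL : Leopoldt ℓ L) {x : GlobalGroup ℓ L} {D : Divisors ℓ K}
    (hx : x ∈ pseudoInfinitesimals ℓ L) (hdiv : divisor ℓ L x = extendDivisor ℓ K L D)
    (σ : Gal(L/K)) :
    ∃ ζ : Lˣ, (∃ k : ℕ, ζ ^ ℓ ^ k = 1) ∧ galoisAction σ x = x + 1 ⊗ₜ Additive.ofMul ζ := by
  obtain ⟨hσ, hσdiv⟩ := galois_action_pseudoInfinitesimals σ hx hdiv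
  obtain ⟨ζ, hζ, h⟩ := exists_rootOfUnity_of_divisor_eq_zero hL (sub_mem hσ hx)
    (by rw [map_sub, hσdiv, hdiv, sub_self])
  exact ⟨ζ, hζ, by rw [← h, add_sub_cancel]; rfl⟩

/-- A `K_v`-automorphism `σ` of `L_w` that fixes the roots of unity of `ℓ`-power order fixes the
localisation of `x`, hence `x` itself, as `σ x / x` is a root of unity. So the field fixed by the
stabiliser of `x` lies in the extension of `K_v` generated by the roots of unity of `L_w`. -/
theorem algebraMap_mem_adjoin_rootsOfUnity [IsGalois K L] (hL : Leopoldt ℓ L)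
    {x : GlobalGroup ℓ L} {D : Divisors ℓ K} (hx : x ∈ pseudoInfinitesimals ℓ L)
    (hdiv : divisor ℓ L x = extendDivisor ℓ K L D) {v : HeightOneSpectrum (𝓞 K)}
    {w : HeightOneSpectrum (𝓞 L)} {c : v.adicCompletion K →+* w.adicCompletion L}
    (hc : IsLocalEmbedding c) {y : L}
    (hy : y ∈ IntermediateField.fixedField (globalStabilizer K x)) :
    letI := c.toAlgebra
    algebraMap L _ y ∈ IntermediateField.adjoin (v.adicCompletion K)
      {ζ : w.adicCompletion L | ∃ n : ℕ, ζ ^ ℓ ^ n = 1} := by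
  let := c.toAlgebra
  have := hc.isScalarTower
  have := finiteDimensional_of_span_range_eq_top (K := K) (L := L) _ _ hc.span_range_eq_top
  have := isGalois_of_span_range_eq_top (K := K) (L := L) _ _ hc.span_range_eq_top
  set M := IntermediateField.adjoin (v.adicCompletion K)
    {ζ : w.adicCompletion L | ∃ n : ℕ, ζ ^ ℓ ^ n = 1}
  rw [← IsGalois.fixedField_fixingSubgroup M, IntermediateField.mem_fixedField_iff]
  intro σ hσ
  let τ : Gal(L/K) := (σ.restrictScalars K).restrictNormal L
  have hτ (y : L) : σ (algebraMap L (w.adicCompletion L) y) = algebraMap L _ (τ y) :=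
    ((σ.restrictScalars K).restrictNormal_commutes L y).symm
  have hσζ (ζ : (w.adicCompletion L)ˣ) (hζ : ∃ k : ℕ, ζ ^ ℓ ^ k = 1) :
      σ (ζ : w.adicCompletion L) = ζ := by
    refine (IntermediateField.mem_fixingSubgroup_iff M σ).1 hσ _
      (IntermediateField.subset_adjoin _ _ ?_)
    obtain ⟨k, hk⟩ := hζ
    exact ⟨k, by rw [← Units.val_pow_eq_pow_val, hk, Units.val_one]⟩
  have hloc : localization ℓ w (galoisAction τ x) =
      ProCompletion.map ℓ (unitsMap (σ : w.adicCompletion L →+* w.adicCompletion L))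
        (localization ℓ w x) := localization_baseChange (τ := (τ : L →+* L)) hτ x
  have hfix : ProCompletion.map ℓ (unitsMap (σ : w.adicCompletion L →+* w.adicCompletion L))
      (localization ℓ w x) = localization ℓ w x := by
    refine ProCompletion.ext_eval fun n => ?_
    obtain ⟨z, ζ, hζ, h⟩ := exists_eval_localization_eq hx hdiv w n
    have h0 := ProCompletion.eval_map_eq_zero
      (unitsMap (σ : w.adicCompletion L →+* w.adicCompletion L))
      ((map_sub (ProCompletion.eval ℓ _ n) _ _).trans (sub_eq_zero.2 h))
    rw [map_sub, map_sub, sub_eq_zero, ProCompletion.map_of] at h0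
    rw [h0, h]
    congr 2
    refine congrArg Additive.ofMul (Units.ext ?_)
    change σ (algebraMap L _ (algebraMap K L z) * ζ) = algebraMap L _ (algebraMap K L z) * ζ
    rw [map_mul, hσζ ζ hζ, hτ, τ.commutes]
  obtain ⟨ζ, ⟨k, hk⟩, hζ⟩ := exists_galoisAction_eq hL hx hdiv τ
  have hζ1 : ζ = 1 := by
    have h1 : localization ℓ w (1 ⊗ₜ Additive.ofMul ζ) = 0 := by
      rw [hζ, map_add, hfix] at hloc
      exact add_eq_left.1 hloc
    rw [localization_one_tmul] at h1
    have h2 := eq_one_of_of_eq_zero (ζ := Units.map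
      (algebraMap L (w.adicCompletion L) : L →* w.adicCompletion L) ζ)
      ⟨k, by rw [← map_pow, hk, map_one]⟩ h1
    exact Units.map_injective (algebraMap L (w.adicCompletion L)).injective
      (h2.trans (map_one _).symm)
  have hmem : τ ∈ globalStabilizer K x := by
    rw [mem_globalStabilizer, hζ, hζ1, ofMul_one, TensorProduct.tmul_zero, add_zero]
  rw [IntermediateField.mem_fixedField_iff] at hy
  rw [hτ, hy τ hmem]

/-- The field fixed by the stabiliser of a pseudo-infinitesimal element whose divisor is extended
from `K` is locally cyclotomic. -/
theorem isLocallyCyclotomic_fixedField [IsGalois K L] (hodd : Odd (Nat.card Gal(L/K)))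
    {n : ℕ} (hn : Nat.card Gal(L/K) = ℓ ^ n) (hL : Leopoldt ℓ L)
    {x : GlobalGroup ℓ L} {D : Divisors ℓ K} (hx : x ∈ pseudoInfinitesimals ℓ L)
    (hdiv : divisor ℓ L x = extendDivisor ℓ K L D) :
    IsLocallyCyclotomic ℓ K (IntermediateField.fixedField (globalStabilizer K x)) := by
  refine isLocallyCyclotomic_of_forall_apply_mem hodd fun w v _ c hc φ hφ y hy => ?_
  have hmem := algebraMap_mem_adjoin_rootsOfUnity hL hx hdiv hc hy
  let := c.toAlgebra
  have := hc.isScalarTower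
  have := finiteDimensional_of_span_range_eq_top (K := K) (L := L) _ _ hc.span_range_eq_top
  have := isGalois_of_span_range_eq_top (K := K) (L := L) _ _ hc.span_range_eq_top
  let ψ : w.adicCompletion L →ₐ[v.adicCompletion K] AlgebraicClosure (v.adicCompletion K) :=
    { φ with commutes' := fun a => DFunLike.congr_fun hφ a }
  exact map_adjoin_rootsOfUnity_le_cyclotomicZl
    (hn ▸ card_algEquiv_dvd_of_span_range_eq_top hc.span_range_eq_top) ψ ⟨_, hmem, rfl⟩

/-- A capitulating class already capitulates in any `F` such that `Gal(L/F)` fixes a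
pseudo-infinitesimal generator of its extension to `L`. -/
theorem mk_mem_capitulation_of_fixed {F : IntermediateField K L} [IsGalois F L]
    {x : GlobalGroup ℓ L} {D : Divisors ℓ K} (hx : x ∈ pseudoInfinitesimals ℓ L)
    (hdiv : divisor ℓ L x = extendDivisor ℓ K L D)
    (hfix : ∀ σ : Gal(L/F), galoisAction σ x = x) :
    Submodule.Quotient.mk D ∈ capitulation ℓ K F := by
  obtain ⟨y, rfl⟩ := exists_extendGlobal_eq hfix
  refine mk_mem_capitulation_iff.2 ⟨y, mem_pseudoInfinitesimals_of_extendGlobal_mem hx, ?_⟩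
  apply extendDivisor_injective (L := L)
  rw [extendDivisor_extendDivisor, ← divisor_extendGlobal, hdiv]

theorem capitulation_le_capitulation (F : IntermediateField K L) :
    capitulation ℓ K F ≤ capitulation ℓ K L := by
  intro C hC
  obtain ⟨D, rfl⟩ := Submodule.Quotient.mk_surjective _ C
  obtain ⟨y, hy, hdiv⟩ := mk_mem_capitulation_iff.1 hC
  refine mk_mem_capitulation_iff.2
    ⟨extendGlobal ℓ F L y, extendGlobal_mem_pseudoInfinitesimals hy, ?_⟩
  rw [divisor_extendGlobal, hdiv, extendDivisor_extendDivisor]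

end Capitulation

end PseudoInfinitesimal

theorem mainTheorem6 (ℓ : ℕ) [Fact ℓ.Prime] (hℓ : ℓ ≠ 2)
    (K : Type*) [Field K] [NumberField K] (hμ : ∃ ζ : K, IsPrimitiveRoot ζ ℓ)
    (L : Type*) [Field L] [NumberField L] [Algebra K L] [IsGalois K L]
    (hG : IsPGroup ℓ Gal(L/K)) (hL : PseudoInfinitesimal.Leopoldt ℓ L) :
    IsGreatest {F : IntermediateField K L | PseudoInfinitesimal.IsLocallyCyclotomic ℓ K F}
        (PseudoInfinitesimal.maxLocallyCyclotomic ℓ K L) ∧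
      PseudoInfinitesimal.capitulation ℓ K L =
        PseudoInfinitesimal.capitulation ℓ K (PseudoInfinitesimal.maxLocallyCyclotomic ℓ K L) := by
  obtain ⟨n, hn⟩ := IsPGroup.iff_card.1 hG
  have hodd : Odd (Nat.card Gal(L/K)) := hn ▸ ((Fact.out : ℓ.Prime).odd_of_ne_two hℓ).pow
  refine ⟨⟨PseudoInfinitesimal.isLocallyCyclotomic_maxLocallyCyclotomic hodd,
    fun F hF => le_sSup hF⟩, le_antisymm (fun C hC => ?_)
    (PseudoInfinitesimal.capitulation_le_capitulation _)⟩
  obtain ⟨D, rfl⟩ := Submodule.Quotient.mk_surjective _ C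
  obtain ⟨x, hx, hdiv⟩ := PseudoInfinitesimal.mk_mem_capitulation_iff.1 hC
  have hle : IntermediateField.fixedField (PseudoInfinitesimal.globalStabilizer K x) ≤
      PseudoInfinitesimal.maxLocallyCyclotomic ℓ K L :=
    le_sSup (PseudoInfinitesimal.isLocallyCyclotomic_fixedField hodd hn hL hx hdiv)
  refine PseudoInfinitesimal.mk_mem_capitulation_of_fixed hx hdiv fun σ => ?_
  have hσ : σ.restrictScalars K ∈ PseudoInfinitesimal.globalStabilizer K x := by
    rw [← IntermediateField.fixingSubgroup_fixedField (PseudoInfinitesimal.globalStabilizer K x),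
      IntermediateField.mem_fixingSubgroup_iff]
    exact fun y hy => σ.commutes ⟨y, hle hy⟩
  exact hσ
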